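/- **Notation and definitions.** Let $B$ be a separable real Banach space with norm $\|\cdot\|_B$. A sequence $(X_i)_{i\ge1}$ of integrable $B$-valued random variables is a martingale differences sequence for a non-decreasing sequence $(\mathcal F_i)_{i\geq 1}$ of sub-$\sigma$-algebras if $X_i$ is $\mathcal F_i$-measurable for all $i\ge1$ and $\mathbb E[X_i\mid\mathcal F_{i-1}]=0$ a.s. for all $i\ge 2$. The space $B$ is $(2,D)$-smooth if there is an equivalent norm $\|\cdot\|$ on $B$ with $$\sup_{t>0}\frac1{t^2}\sup\{\|x+ty\|+\|x-ty\|-2:\ \|x\|=\|y\|=1\}<\infty$$ and if $\mathbb E\big\|\sum_{i=1}^nX_i\big\|_B^2\le D\sum_{i=1}^n\mathbb E\|X_i\|_B^2$ for every $B$-valued martingale differences sequence $(X_i)_{i\ge1}$ and every $n$. Let $T_1,\dots,T_d$ be pairwise commuting, bijective, bi-measurable, measure preserving transformations of a probability space $(\Omega,\mathcal F,\mathbb P)$, and put $T^{\mathbf i}=T_1^{i_1}\cdots T_d^{i_d}$ for $\mathbf i\in\mathbb Z^d$. Let $\mathcal F_{\mathbf 0}\subset\mathcal F$ be a sub-$\sigma$-algebra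 with $\mathcal F_{\mathbf 0}\subset T_q^{-1}\mathcal F_{\mathbf 0}$ for each $q$, and put $\mathcal F_{\mathbf i}=T^{-\mathbf i}\mathcal F_{\mathbf 0}$. Let $\preccurlyeq$ and $\wedge$ be the coordinatewise order and minimum. The filtration is completely commuting if $\mathbb E[Y\mid\mathcal F_{\mathbf k}]=\mathbb E[Y\mid\mathcal F_{\mathbf k\wedge\mathbf l}]$ a.s. for all $\mathbf k,\mathbf l\in\mathbb Z^d$ and every integrable $\mathcal F_{\mathbf l}$-measurable real random variable $Y$. For $m\colon\Omega\to B$ and $\mathbf n\in\mathbb Z_+^d$ let $S_{\mathbf n}(m)=\sum_{\mathbf 0\preccurlyeq\mathbf i\preccurlyeq\mathbf n-\mathbf 1}m\circ T^{\mathbf i}$ (an empty sum, equal to $0$, if some $n_q=0$). One says that $(m\circ T^{\mathbf i},T^{-\mathbf i}\mathcal F_{\mathbf 0})$ is a $B$-valued strictly stationary orthomartingale differences random field if the filtration is completely commuting, each $S_{\mathbf n}(m)$ is $\mathcal F_{\mathbf n}$-measurable and integrable, and $\mathbb E[S_{\mathbf j}(m)\mid\mathcal F_{\mathbf i}]=S_{\mathbf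 i}(m)$ a.s. for all $\mathbf i\preccurlyeq\mathbf j$ in $\mathbb Z_+^d$. Write $m\in\mathbb L^{s,\infty}$ if $\sup_{t>0}t^s\mathbb P\{\|m\|_B>t\}<\infty$, $m\in\mathbb L^{s,\infty}_0$ if $\lim_{t\to+\infty}t^s\mathbb P\{\|m\|_B>t\}=0$, and $m\in\mathbb L^s$ if $\mathbb E\|m\|_B^s<\infty$. For $\mathbf n\in\mathbb Z_+^d$ let $\mathbf{2^n}=(2^{n_1},\dots,2^{n_d})$, $|\mathbf{2^n}|=\prod_{q=1}^d2^{n_q}$, and for $x>0$ $$a_{\mathbf n}(x)=|\mathbf{2^n}|^{s/2}\,\mathbb P\Big\{\max_{\mathbf 1\preccurlyeq\mathbf i\preccurlyeq\mathbf{2^n}}\|S_{\mathbf i}(m)\|_B>|\mathbf{2^n}|\,x\Big\}.$$ **Theorem.** Let $s>2$, let $B$ be a separable $(2,D)$-smooth Banach space and let $d\ge2$ be an integer. There is a constant $C(s,d,B)$ such that for each $B$-valued strictly stationary orthomartingale differences random field $(m\circ T^{\mathbf i},T^{-\mathbf i}\mathcal F_{\mathbf 0})$ (on any probability space) the following holds.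 1. If $m\in\mathbb L^{s,\infty}$, then for each $x>0$, $$\sup_{\mathbf n\succcurlyeq\mathbf 1}a_{\mathbf n}(x)\le C(s,d,B)\,x^{-s}\sup_{t>0}t^s\,\mathbb P\{\|m\|_B>t\}.$$ 2. If $m\in\mathbb L^{s,\infty}_0$, then for each $x>0$, $a_{\mathbf n}(x)\to0$ as $\max_{1\le q\le d}n_q\to+\infty$, $\mathbf n\in\mathbb Z_+^d$. 3. If $m\in\mathbb L^s$, then for each $x>0$ and each $i\in\{1,\dots,d\}$, $$\sup_{\substack{n_j\ge1\\ 1\le j\le d,\ j\ne i}}\ \sum_{n_i=1}^{+\infty}a_{\mathbf n}(x)\le C(s,d,B)\,x^{-s}\,\mathbb E\|m\|_B^s .$$ -/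

import Mathlib

open MeasureTheory Filter Topology
open scoped ENNReal NNReal

universe u v

/-- `B` is `r`-smooth: there are an equivalent norm `N` on `B` and a constant `K` with
`N (x + t y) + N (x - t y) - 2 ≤ K t ^ r` for all `t > 0` and all `x`, `y` of `N`-norm one. -/
def IsSmoothSpace (B : Type*) [NormedAddCommGroup B] [NormedSpace ℝ B] (r : ℝ) : Prop :=
  ∃ N : Seminorm ℝ B,
    (∃ a b : ℝ, 0 < a ∧ 0 < b ∧ ∀ x : B, a * ‖x‖ ≤ N x ∧ N x ≤ b * ‖x‖) ∧
    ∃ K : ℝ, ∀ t : ℝ, 0 < t → ∀ x y : B, N x = 1 → N y = 1 →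
      (N (x + t • y) + N (x - t • y) - 2) / t ^ r ≤ K

/-- `X 0, X 1, …` is a `B`-valued martingale differences sequence with respect to the
non-decreasing sequence of sub-sigma-algebras `ℱ 0, ℱ 1, …`. -/
structure IsMartingaleDifferenceSeq {Ω : Type*} {mΩ : MeasurableSpace Ω}
    {B : Type*} [NormedAddCommGroup B] [NormedSpace ℝ B] [CompleteSpace B]
    (μ : Measure Ω) (ℱ : Filtration ℕ mΩ) (X : ℕ → Ω → B) : Prop where
  measurable : ∀ i, StronglyMeasurable[ℱ i] (X i)
  integrable : ∀ i, Integrable (X i) μ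
  condExp_eq_zero : ∀ i, μ[X (i + 1) | ℱ i] =ᵐ[μ] 0

/-- `B` is `(r, D)`-smooth: it is `r`-smooth and
`E ‖X 0 + ⋯ + X (n - 1)‖ ^ r ≤ D * ∑ i < n, E ‖X i‖ ^ r` for every `B`-valued martingale
differences sequence `X`, on any probability space. The expectations are taken in `[0, ∞]`. -/
def IsRDSmooth (B : Type v) [NormedAddCommGroup B] [NormedSpace ℝ B] [CompleteSpace B]
    (r D : ℝ) : Prop :=
  IsSmoothSpace B r ∧
  ∀ (Ω : Type u) (mΩ : MeasurableSpace Ω) (μ : Measure Ω), IsProbabilityMeasure μ →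
    ∀ (ℱ : Filtration ℕ mΩ) (X : ℕ → Ω → B), IsMartingaleDifferenceSeq μ ℱ X → ∀ n : ℕ,
      ∫⁻ ω, ‖∑ i ∈ Finset.range n, X i ω‖ₑ ^ r ∂μ
        ≤ ENNReal.ofReal D * ∑ i ∈ Finset.range n, ∫⁻ ω, ‖X i ω‖ₑ ^ r ∂μ

namespace Orthomartingale

variable {Ω : Type*} {d : ℕ}

/-- `T ^ i`, the composition of the `T q ^ i q`, `q = 1, …, d`, for `i` in `ℤ ^ d`. It is used
for pairwise commuting `T q` only, so that the order of composition is irrelevant. -/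
def shift {mΩ : MeasurableSpace Ω} (T : Fin d → Ω ≃ᵐ Ω) (i : Fin d → ℤ) : Equiv.Perm Ω :=
  (List.ofFn fun q => ((T q).toEquiv : Equiv.Perm Ω) ^ i q).prod

/-- The sigma-algebra `T ^ (-i) F₀`, consisting of the preimages under `T ^ i` of the elements
of `F₀`. -/
abbrev shiftedAlgebra {mΩ : MeasurableSpace Ω} (T : Fin d → Ω ≃ᵐ Ω) (F₀ : MeasurableSpace Ω)
    (i : Fin d → ℤ) : MeasurableSpace Ω :=
  F₀.comap (shift T i)

/-- The sum `S_n(m)` of the `m ∘ T ^ i` over all `i` in `ℕ ^ d` with `0 ≤ i q ≤ n q - 1` for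
each `q` (an empty sum if some `n q` vanishes). -/
def partialSum {mΩ : MeasurableSpace Ω} {B : Type*} [AddCommMonoid B]
    (T : Fin d → Ω ≃ᵐ Ω) (m : Ω → B) (n : Fin d → ℕ) (ω : Ω) : B :=
  ∑ i ∈ Fintype.piFinset fun q => Finset.range (n q), m (shift T (fun q => (i q : ℤ)) ω)

/-- The maximum of `‖S_i(m)‖` over `1 ≼ i ≼ n` (coordinatewise order). -/
def maxPartialSum {mΩ : MeasurableSpace Ω} {B : Type*} [NormedAddCommGroup B]
    (T : Fin d → Ω ≃ᵐ Ω) (m : Ω → B) (n : Fin d → ℕ) (ω : Ω) : ℝ≥0 :=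
  (Finset.Icc 1 n).sup fun i => ‖partialSum T m i ω‖₊

/-- The maps `T q` (bijective and bi-measurable by their type) are measure preserving and commute
with each other. -/
structure IsCommutingMeasurePreserving {mΩ : MeasurableSpace Ω} (μ : Measure Ω)
    (T : Fin d → Ω ≃ᵐ Ω) : Prop where
  measurePreserving : ∀ q, MeasurePreserving (T q) μ μ
  commute : ∀ q q' ω, T q (T q' ω) = T q' (T q ω)

/-- `F₀` is a sub-sigma-algebra with `F₀ ⊆ T q ^ (-1) F₀` for each `q`, and the filtration
`F_i = T ^ (-i) F₀`, `i ∈ ℤ ^ d`, is completely commuting: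
`E[Y | F_k] = E[Y | F_(k ∧ l)]` for each integrable `F_l`-measurable `Y`. -/
structure IsCompletelyCommuting {mΩ : MeasurableSpace Ω} (μ : Measure Ω)
    (T : Fin d → Ω ≃ᵐ Ω) (F₀ : MeasurableSpace Ω) : Prop where
  transformations : IsCommutingMeasurePreserving μ T
  le : F₀ ≤ mΩ
  le_comap : ∀ q, F₀ ≤ F₀.comap (T q)
  condExp_inf : ∀ (k l : Fin d → ℤ) (Y : Ω → ℝ), Integrable Y μ →
    Measurable[shiftedAlgebra T F₀ l] Y →
    μ[Y | shiftedAlgebra T F₀ k] =ᵐ[μ] μ[Y | shiftedAlgebra T F₀ (k ⊓ l)]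

/-- `(M_n)`, `n ∈ ℕ ^ d`, is an orthomartingale random field with respect to the filtration
`(T ^ (-i) F₀)`. -/
structure IsOrthomartingale {mΩ : MeasurableSpace Ω} {B : Type*}
    [NormedAddCommGroup B] [NormedSpace ℝ B] [CompleteSpace B] (μ : Measure Ω)
    (T : Fin d → Ω ≃ᵐ Ω) (F₀ : MeasurableSpace Ω) (M : (Fin d → ℕ) → Ω → B) : Prop where
  completelyCommuting : IsCompletelyCommuting μ T F₀
  measurable : ∀ n, StronglyMeasurable[shiftedAlgebra T F₀ fun q => (n q : ℤ)] (M n)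
  integrable : ∀ n, Integrable (M n) μ
  condExp_eq : ∀ i j : Fin d → ℕ, i ≤ j →
    μ[M j | shiftedAlgebra T F₀ fun q => (i q : ℤ)] =ᵐ[μ] M i

/-- `(m ∘ T ^ i)` is a (strictly stationary) orthomartingale differences random field with
respect to `(T ^ (-i) F₀)`: the partial sums `S_n(m)` form an orthomartingale random field. -/
def IsOrthomartingaleDifference {mΩ : MeasurableSpace Ω} {B : Type*}
    [NormedAddCommGroup B] [NormedSpace ℝ B] [CompleteSpace B] (μ : Measure Ω)
    (T : Fin d → Ω ≃ᵐ Ω) (F₀ : MeasurableSpace Ω) (m : Ω → B) : Prop :=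
  IsOrthomartingale μ T F₀ fun n => partialSum T m n

/-- `sup_{t > 0} t ^ s * P(‖X‖ > t)`, an element of `[0, ∞]`. -/
noncomputable def weakMoment {mΩ : MeasurableSpace Ω} {B : Type*} [NormedAddCommGroup B]
    (s : ℝ) (X : Ω → B) (μ : Measure Ω) : ℝ≥0∞ :=
  ⨆ (t : ℝ) (_ : 0 < t), ENNReal.ofReal (t ^ s) * μ {ω | t < ‖X ω‖}

/-- Membership in `L^{s, ∞}`. -/
def MemWeakLp {mΩ : MeasurableSpace Ω} {B : Type*} [NormedAddCommGroup B]
    (s : ℝ) (X : Ω → B) (μ : Measure Ω) : Prop :=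
  AEStronglyMeasurable X μ ∧ weakMoment s X μ < ∞

/-- Membership in `L_0^{s, ∞}`. -/
def MemWeakLpZero {mΩ : MeasurableSpace Ω} {B : Type*} [NormedAddCommGroup B]
    (s : ℝ) (X : Ω → B) (μ : Measure Ω) : Prop :=
  AEStronglyMeasurable X μ ∧
    Tendsto (fun t : ℝ => ENNReal.ofReal (t ^ s) * μ {ω | t < ‖X ω‖}) atTop (𝓝 0)

/-- `|2 ^ n| = 2 ^ n_1 ⋯ 2 ^ n_d`, for `n` in `ℕ ^ d`. -/
noncomputable def absTwoPow (n : Fin d → ℕ) : ℝ := ∏ q, (2 : ℝ) ^ n q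

/-- `|2 ^ n| ^ (s / 2) * P(max_{1 ≼ i ≼ 2 ^ n} ‖S_i(m)‖ > |2 ^ n| x)`. -/
noncomputable def weightedTail {mΩ : MeasurableSpace Ω} {B : Type*} [NormedAddCommGroup B]
    (μ : Measure Ω) (T : Fin d → Ω ≃ᵐ Ω) (m : Ω → B) (s x : ℝ) (n : Fin d → ℕ) : ℝ≥0∞ :=
  ENNReal.ofReal (absTwoPow n ^ (s / 2)) *
    μ {ω | absTwoPow n * x < maxPartialSum T m (fun q => 2 ^ n q) ω}

end Orthomartingale

/-!
The proof rests on the `2`-smooth equivalent norm `N` of `B`, on Doob's inequality in each direction,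
and on a truncation in the spirit of Marcinkiewicz interpolation.

*Moments.* For an even integer `p`, smoothness gives
`N (x + y) ^ p + N (x - y) ^ p ≤ 2 N x ^ p + L (N x ^ (p - 2) N y ^ 2 + N y ^ p)`.
If `S` is a sum of martingale differences and `X` is the next difference, then
`E N (S - X) ^ p ≥ E N S ^ p` by Jensen's inequality, so `E N (S + X) ^ p` exceeds `E N S ^ p` by a
controlled amount; a Gronwall argument then bounds the `p`-th moment of a sum of `n` differences by
a constant times `n ^ (p / 2)` times the largest `p`-th moment of a difference
(`Seminorm.integral_sum_pow_le`). By complete commutation, the sums of an orthomartingale field over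
boxes form a martingale in each direction. Iterating the moment inequality and Doob's inequality
over the `d` directions yields
`E max ‖S_i(m)‖ ^ p ≤ C V ^ (p / 2) E ‖m‖ ^ p` for boxes of volume `V`
(`exists_lintegral_maxPartialSum_pow_le`).

*Truncation.* Let `y = V ^ (1 / 2) x`, split `m` according to whether `‖m‖ ≤ y`, and apply to both
parts the product over the directions `q` of the commuting operators
`Y ↦ Y - E[Y | F_(1 - e_q)]` (`centering`), which leave `m` invariant and produce orthomartingale
differences. The moment inequality with an exponent `p > s` for the first part and with exponent `2`
for the second one gives
`P(max ‖S_i(m)‖ > V x) ≤ C (y ^ (-p) E[‖m‖ ^ p; ‖m‖ ≤ y] + y ^ (-2) E[‖m‖ ^ 2; ‖m‖ > y])`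
(`exists_measure_maxPartialSum_le`).

*Conclusion.* Decomposing the values of `‖m‖` dyadically and using `2 < s < p`, the right hand side
multiplied by `y ^ s` is at most `∑ c_k h(2 ^ k y)` over `k ∈ ℤ`, where `h(t) = t ^ s P(‖m‖ > t)` and
the `c_k` are summable (`exists_weightedTail_le`). The three claims correspond to `h` being bounded,
to `h` tending to zero at infinity, and to the sums of `h` along geometric progressions being
controlled by `E ‖m‖ ^ s`.
-/

/-! ### Moments of martingales in a smooth space -/

section Smoothness

theorem one_add_pow_le_add_sq {h : ℝ} (h₁ : |h| ≤ 1) (p : ℕ) :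
    (1 + h) ^ p ≤ 1 + p * h + 4 ^ p * h ^ 2 := by
  obtain ⟨hl, hu⟩ := abs_le.1 h₁
  induction p with
  | zero => simp; positivity
  | succ p ih =>
    have hp : (p : ℝ) ≤ 4 ^ p := by
      exact_mod_cast (Nat.lt_pow_self (by norm_num : 1 < 4)).le
    calc (1 + h) ^ (p + 1) = (1 + h) * (1 + h) ^ p := by ring
      _ ≤ (1 + h) * (1 + p * h + 4 ^ p * h ^ 2) := by gcongr; linarith
      _ = 1 + (p + 1) * h + (p + 4 ^ p * (1 + h)) * h ^ 2 := by ring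
      _ ≤ 1 + (p + 1) * h + (4 ^ p + 4 ^ p * 2) * h ^ 2 := by gcongr; linarith
      _ ≤ 1 + ((p + 1 : ℕ) : ℝ) * h + 4 ^ (p + 1) * h ^ 2 := by
        push_cast; nlinarith [sq_nonneg h, pow_pos (by norm_num : (0 : ℝ) < 4) p, pow_succ (4 : ℝ) p]

variable {B : Type*} [NormedAddCommGroup B] [NormedSpace ℝ B]

/-- The modulus of smoothness controls all powers `p + 2` of the norm, not only vectors of norm one:
by homogeneity the hypothesis bounds `N (x + y) + N (x - y) - 2 * N x` when `N y ≤ N x`, and the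
second order expansion of `t ↦ t ^ (p + 2)` at `N x` gives the claim. When `N x < N y` the triangle
inequality suffices. -/
theorem Seminorm.add_pow_add_sub_pow_le {N : Seminorm ℝ B} {K : ℝ}
    (hK : ∀ t : ℝ, 0 < t → ∀ x y : B, N x = 1 → N y = 1 →
      (N (x + t • y) + N (x - t • y) - 2) / t ^ (2 : ℝ) ≤ K) (p : ℕ) :
    ∃ L : ℝ, 0 ≤ L ∧ ∀ x y : B, N (x + y) ^ (p + 2) + N (x - y) ^ (p + 2) ≤
      2 * N x ^ (p + 2) + L * (N x ^ p * N y ^ 2 + N y ^ (p + 2)) := by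
  refine ⟨(p + 2) * |K| + 2 * 4 ^ (p + 2) + 2 * 2 ^ (p + 2), by positivity, fun x y => ?_⟩
  have hx := apply_nonneg N x
  have hy := apply_nonneg N y
  have hadd : N (x + y) ≤ N x + N y := map_add_le_add N x y
  have hsub : N (x - y) ≤ N x + N y := map_sub_le_add N x y
  have hadd₀ := apply_nonneg N (x + y)
  have hsub₀ := apply_nonneg N (x - y)
  rcases hy.eq_or_lt with hy0 | hy0
  · rw [← hy0] at hadd hsub ⊢
    rw [add_zero] at hadd hsub
    have h1 := pow_le_pow_left₀ hadd₀ hadd (p + 2)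
    have h2 := pow_le_pow_left₀ hsub₀ hsub (p + 2)
    simp
    linarith
  rcases lt_or_ge (N x) (N y) with hlt | hle
  · have h1 : N (x + y) ^ (p + 2) ≤ (2 * N y) ^ (p + 2) := by gcongr; linarith
    have h2 : N (x - y) ^ (p + 2) ≤ (2 * N y) ^ (p + 2) := by gcongr; linarith
    rw [mul_pow] at h1 h2
    have h3 : 0 ≤ ((p + 2) * |K| + 2 * 4 ^ (p + 2)) * (N x ^ p * N y ^ 2 + N y ^ (p + 2)) := by
      positivity
    have h4 : 0 ≤ 2 * (2 : ℝ) ^ (p + 2) * (N x ^ p * N y ^ 2) := by positivity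
    have h5 : 0 ≤ 2 * N x ^ (p + 2) := by positivity
    nlinarith
  · have hx0 : 0 < N x := hy0.trans_le hle
    set r : ℝ := N y / N x with hr
    have hr0 : 0 < r := by positivity
    have hr1 : r ≤ 1 := (div_le_one hx0).2 hle
    have hscale : ∀ z : B, N ((N x)⁻¹ • z) = (N x)⁻¹ * N z := fun z => by
      rw [map_smul_eq_mul, Real.norm_of_nonneg (by positivity)]
    have hx' : N ((N x)⁻¹ • x) = 1 := by rw [hscale]; field_simp
    have hy' : N ((N y)⁻¹ • y) = 1 := by
      rw [map_smul_eq_mul, Real.norm_of_nonneg (by positivity)]; field_simp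
    have hry : r • (N y)⁻¹ • y = (N x)⁻¹ • y := by
      rw [smul_smul]; congr 1; rw [hr]; field_simp
    have hk := hK r hr0 _ _ hx' hy'
    rw [hry, ← smul_add, ← smul_sub, hscale, hscale, Real.rpow_two, div_le_iff₀ (by positivity)]
      at hk
    set u := (N x)⁻¹ * N (x + y) with hu
    set v := (N x)⁻¹ * N (x - y) with hv
    have hxu : N (x + y) = N x * u := by rw [hu]; field_simp
    have hxv : N (x - y) = N x * v := by rw [hv]; field_simp
    have hyr : N y = N x * r := by rw [hr]; field_simp
    have key : ∀ w : ℝ, N x * w ≤ N x + N y → N x ≤ N x * w + N y →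
        w ^ (p + 2) ≤ 1 + (p + 2) * (w - 1) + 4 ^ (p + 2) * r ^ 2 := fun w h1 h2 => by
      rw [hyr] at h1 h2
      have hw1 : w - 1 ≤ r := by
        have : w ≤ 1 + r := le_of_mul_le_mul_left (by linarith) hx0
        linarith
      have hw2 : -r ≤ w - 1 := by
        have : 1 ≤ w + r := le_of_mul_le_mul_left (by linarith) hx0
        linarith
      have hw := one_add_pow_le_add_sq (h := w - 1) (abs_le.2 ⟨by linarith, by linarith⟩) (p + 2)
      have hsq : (w - 1) ^ 2 ≤ r ^ 2 := sq_le_sq' hw2 hw1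
      rw [add_sub_cancel] at hw
      push_cast at hw
      refine hw.trans ?_
      gcongr
    have hu' := key u (by rw [← hxu]; exact hadd) (by
      rw [← hxu]; simpa using map_sub_le_add N (x + y) y)
    have hv' := key v (by rw [← hxv]; exact hsub) (by
      rw [← hxv]; simpa using map_add_le_add N (x - y) y)
    have huv : u ^ (p + 2) + v ^ (p + 2) ≤
        2 + ((p + 2) * |K| + 2 * 4 ^ (p + 2)) * r ^ 2 := by
      have : (p + 2 : ℝ) * (u + v - 2) ≤ (p + 2) * (|K| * r ^ 2) := by
        gcongr; exact hk.trans (by gcongr; exact le_abs_self K)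
      linarith
    calc N (x + y) ^ (p + 2) + N (x - y) ^ (p + 2)
        = N x ^ (p + 2) * (u ^ (p + 2) + v ^ (p + 2)) := by rw [hxu, hxv]; ring
      _ ≤ N x ^ (p + 2) * (2 + ((p + 2) * |K| + 2 * 4 ^ (p + 2)) * r ^ 2) := by gcongr
      _ = 2 * N x ^ (p + 2) + ((p + 2) * |K| + 2 * 4 ^ (p + 2)) * (N x ^ p * N y ^ 2) := by
        rw [hyr]; ring
      _ ≤ 2 * N x ^ (p + 2) + ((p + 2) * |K| + 2 * 4 ^ (p + 2) + 2 * 2 ^ (p + 2)) *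
          (N x ^ p * N y ^ 2 + N y ^ (p + 2)) := by
        have h1 : 0 ≤ N y ^ (p + 2) := pow_nonneg hy _
        refine add_le_add le_rfl (mul_le_mul ?_ ?_ (by positivity) (by positivity))
        · exact le_add_of_nonneg_right (by positivity)
        · exact le_add_of_nonneg_right h1

/-- A form of Young's inequality. The parameter `n` will be the number of summands, so that summing
`n` times the term `a ^ (2 * j + 2) / n` costs only a constant factor. -/
theorem pow_mul_sq_le {a b n : ℝ} (ha : 0 ≤ a) (hb : 0 ≤ b) (hn : 0 < n) (j : ℕ) :
    a ^ (2 * j) * b ^ 2 ≤ a ^ (2 * j + 2) / n + n ^ j * b ^ (2 * j + 2) := by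
  rcases le_total (n * b ^ 2) (a ^ 2) with h | h
  · have : b ^ 2 ≤ a ^ 2 / n := by rw [le_div_iff₀ hn]; linarith
    calc a ^ (2 * j) * b ^ 2 ≤ a ^ (2 * j) * (a ^ 2 / n) := by gcongr
      _ = a ^ (2 * j + 2) / n := by ring
      _ ≤ _ := le_add_of_nonneg_right (by positivity)
  · calc a ^ (2 * j) * b ^ 2 = (a ^ 2) ^ j * b ^ 2 := by rw [pow_mul]
      _ ≤ (n * b ^ 2) ^ j * b ^ 2 := by gcongr
      _ = n ^ j * b ^ (2 * j + 2) := by ring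
      _ ≤ _ := le_add_of_nonneg_left (by positivity)

/-- A discrete Gronwall inequality, in which the growth factor depends on the final time `n`. -/
theorem le_of_forall_le_one_add_mul_add {a : ℕ → ℝ} {n : ℕ} {L c : ℝ} (hL : 0 ≤ L)
    (hc : 0 ≤ c) (h₀ : a 0 = 0) (ha : ∀ i, a (i + 1) ≤ (1 + L / n) * a i + c) :
    a n ≤ Real.exp L * (n * c) := by
  have h1 : (1 : ℝ) ≤ 1 + L / n := le_add_of_nonneg_right (by positivity)
  have key : ∀ i : ℕ, a i ≤ (1 + L / n) ^ i * (i * c) := fun i => by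
    induction i with
    | zero => simp [h₀]
    | succ i ih =>
      calc a (i + 1) ≤ (1 + L / n) * a i + c := ha i
        _ ≤ (1 + L / n) * ((1 + L / n) ^ i * (i * c)) + (1 + L / n) ^ (i + 1) * c := by
          gcongr
          exact le_mul_of_one_le_left hc (one_le_pow₀ h1)
        _ = _ := by push_cast; ring
  refine (key n).trans ?_
  gcongr
  rcases Nat.eq_zero_or_pos n with rfl | hn
  · simpa using hL
  calc (1 + L / n) ^ n ≤ Real.exp (L / n) ^ n := by
        gcongr; linarith [Real.add_one_le_exp (L / n)]
    _ = Real.exp L := by rw [← Real.exp_nat_mul]; congr 1; field_simp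

theorem Seminorm.integrable_comp_pow {Ω : Type*} {mΩ : MeasurableSpace Ω} {μ : Measure Ω}
    [IsFiniteMeasure μ] {N : Seminorm ℝ B} (hN : Continuous N) {b : ℝ}
    (hb : ∀ x, N x ≤ b * ‖x‖) {p : ℕ} {f : Ω → B}
    (hf : MemLp f p μ) : Integrable (fun ω => N (f ω) ^ p) μ := by
  refine ((hf.integrable_norm_pow').const_mul (b ^ p)).mono'
    ((hN.pow p).comp_aestronglyMeasurable hf.1) (ae_of_all _ fun ω => ?_)
  rw [Real.norm_of_nonneg (pow_nonneg (apply_nonneg N _) p), ← mul_pow]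
  exact pow_le_pow_left₀ (apply_nonneg N _) (hb _) p

/-- Adding to `S` a conditionally centered increment `X` changes the moment of order `2 * j + 2` by
a factor `1 + L / n` and a multiple of the moment of `X`. The parameter `n ≥ 1` is free. -/
theorem Seminorm.integral_add_pow_le {Ω : Type*} {m mΩ : MeasurableSpace Ω} {μ : Measure Ω}
    [IsProbabilityMeasure μ] [CompleteSpace B] {N : Seminorm ℝ B} (hN : Continuous N)
    {b : ℝ} (hb : ∀ x, N x ≤ b * ‖x‖) {L : ℝ} (hL : 0 ≤ L) {j : ℕ}
    (hNL : ∀ x y : B, N (x + y) ^ (2 * j + 2) + N (x - y) ^ (2 * j + 2) ≤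
      2 * N x ^ (2 * j + 2) + L * (N x ^ (2 * j) * N y ^ 2 + N y ^ (2 * j + 2)))
    (hm : m ≤ mΩ) {S X : Ω → B} (hSm : StronglyMeasurable[m] S)
    (hS : MemLp S (2 * j + 2 : ℕ) μ) (hX : MemLp X (2 * j + 2 : ℕ) μ) (hX0 : μ[X | m] =ᵐ[μ] 0)
    {n : ℝ} (hn : 1 ≤ n) :
    ∫ ω, N (S ω + X ω) ^ (2 * j + 2) ∂μ ≤
      (1 + L / n) * ∫ ω, N (S ω) ^ (2 * j + 2) ∂μ +
        2 * L * n ^ j * ∫ ω, N (X ω) ^ (2 * j + 2) ∂μ := by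
  have hp1 : (1 : ℝ≥0∞) ≤ (2 * j + 2 : ℕ) := by
    exact_mod_cast (by omega : 1 ≤ 2 * j + 2)
  have hi₀ := integrable_comp_pow hN hb hS
  have hi₁ := integrable_comp_pow hN hb (hS.add hX)
  have hi₂ := integrable_comp_pow hN hb (hS.sub hX)
  have hi₃ := integrable_comp_pow hN hb hX
  simp only [Pi.add_apply, Pi.sub_apply] at hi₁ hi₂
  -- Jensen's inequality, as `S` is the conditional expectation of `S - X`.
  have hjensen : ∫ ω, N (S ω) ^ (2 * j + 2) ∂μ ≤ ∫ ω, N (S ω - X ω) ^ (2 * j + 2) ∂μ := by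
    have hcond : μ[S - X | m] =ᵐ[μ] S := by
      filter_upwards [condExp_sub (hS.integrable hp1) (hX.integrable hp1) m, hX0] with ω h1 h2
      rw [h1, Pi.sub_apply, h2, condExp_of_stronglyMeasurable hm hSm (hS.integrable hp1)]
      simp
    have hconv : ConvexOn ℝ Set.univ fun x => N x ^ (2 * j + 2) :=
      N.convexOn.pow (fun x _ => apply_nonneg N x) _
    have := hconv.map_condExp_le_univ hm (hN.pow _).lowerSemicontinuous
      ((hS.sub hX).integrable hp1) hi₂
    rw [← integral_condExp hm (f := fun ω => N (S ω - X ω) ^ (2 * j + 2))]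
    refine integral_mono_ae hi₀ integrable_condExp ?_
    filter_upwards [this, hcond] with ω h1 h2
    rw [Function.comp_apply, h2] at h1
    exact h1
  have hpt : ∀ ω, N (S ω + X ω) ^ (2 * j + 2) + N (S ω - X ω) ^ (2 * j + 2) ≤
      (2 + L / n) * N (S ω) ^ (2 * j + 2) + 2 * L * n ^ j * N (X ω) ^ (2 * j + 2) := fun ω => by
    refine (hNL (S ω) (X ω)).trans ?_
    have h1 := pow_mul_sq_le (apply_nonneg N (S ω)) (apply_nonneg N (X ω))
      (by linarith : (0 : ℝ) < n) j
    have h2 : N (X ω) ^ (2 * j + 2) ≤ n ^ j * N (X ω) ^ (2 * j + 2) :=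
      le_mul_of_one_le_left (pow_nonneg (apply_nonneg N _) _) (one_le_pow₀ hn)
    calc _ ≤ 2 * N (S ω) ^ (2 * j + 2) + L * (N (S ω) ^ (2 * j + 2) / n +
          n ^ j * N (X ω) ^ (2 * j + 2) + n ^ j * N (X ω) ^ (2 * j + 2)) := by gcongr
      _ = _ := by ring
  have hint := integral_mono (hi₁.add hi₂) ((hi₀.const_mul _).add (hi₃.const_mul _)) hpt
  simp only [Pi.add_apply] at hint
  rw [integral_add hi₁ hi₂, integral_add (hi₀.const_mul _) (hi₃.const_mul _),
    integral_const_mul, integral_const_mul] at hint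
  linarith

/-- The moment of order `p = 2 * j + 2` of a sum of `n` martingale differences, all of which have
moment of order `p` at most `c`, is at most a constant times `n ^ (p / 2) * c`. -/
theorem Seminorm.integral_sum_pow_le {Ω : Type*} {mΩ : MeasurableSpace Ω} {μ : Measure Ω}
    [IsProbabilityMeasure μ] [CompleteSpace B] {N : Seminorm ℝ B} (hN : Continuous N)
    {b : ℝ} (hb : ∀ x, N x ≤ b * ‖x‖) {L : ℝ} (hL : 0 ≤ L) {j : ℕ}
    (hNL : ∀ x y : B, N (x + y) ^ (2 * j + 2) + N (x - y) ^ (2 * j + 2) ≤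
      2 * N x ^ (2 * j + 2) + L * (N x ^ (2 * j) * N y ^ 2 + N y ^ (2 * j + 2)))
    {ℱ : Filtration ℕ mΩ} {X : ℕ → Ω → B} (hX : ∀ i, StronglyMeasurable[ℱ (i + 1)] (X i))
    (hXp : ∀ i, MemLp (X i) (2 * j + 2 : ℕ) μ) (hX0 : ∀ i, μ[X i | ℱ i] =ᵐ[μ] 0) {c : ℝ}
    (hc : ∀ i, ∫ ω, N (X i ω) ^ (2 * j + 2) ∂μ ≤ c) (n : ℕ) :
    ∫ ω, N (∑ i ∈ Finset.range n, X i ω) ^ (2 * j + 2) ∂μ ≤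
      2 * L * Real.exp L * (n ^ (j + 1) * c) := by
  have hc0 : 0 ≤ c := (integral_nonneg fun ω => pow_nonneg (apply_nonneg N _) _).trans (hc 0)
  have hp1 : (1 : ℝ≥0∞) ≤ (2 * j + 2 : ℕ) := by
    exact_mod_cast (by omega : 1 ≤ 2 * j + 2)
  have hS : ∀ k, MemLp (fun ω => ∑ i ∈ Finset.range k, X i ω) (2 * j + 2 : ℕ) μ :=
    fun k => memLp_finsetSum _ fun i _ => hXp i
  have hSm : ∀ k, StronglyMeasurable[ℱ k] (fun ω => ∑ i ∈ Finset.range k, X i ω) := fun k =>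
    Finset.stronglyMeasurable_fun_sum _ fun i hi =>
      (hX i).mono (ℱ.mono (Finset.mem_range.1 hi))
  rcases Nat.eq_zero_or_pos n with rfl | hn
  · simp
  have hn' : (1 : ℝ) ≤ n := by exact_mod_cast hn
  have step : ∀ k, ∫ ω, N (∑ i ∈ Finset.range (k + 1), X i ω) ^ (2 * j + 2) ∂μ ≤
      (1 + L / n) * ∫ ω, N (∑ i ∈ Finset.range k, X i ω) ^ (2 * j + 2) ∂μ +
        2 * L * n ^ j * c := fun k => by
    simp only [Finset.sum_range_succ]
    refine (integral_add_pow_le hN hb hL hNL (ℱ.le k) (hSm k) (hS k) (hXp k) (hX0 k) hn').trans ?_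
    gcongr
    exact hc k
  refine (le_of_forall_le_one_add_mul_add (a := fun k =>
    ∫ ω, N (∑ i ∈ Finset.range k, X i ω) ^ (2 * j + 2) ∂μ) hL (by positivity) (by simp)
    step).trans_eq ?_
  ring

end Smoothness

/-! ### Doob's inequality for moments -/

/-- Young's inequality with a coefficient of `b ^ (p + 2)` small enough for this term to be absorbed
in the proof of Doob's inequality. -/
theorem ENNReal.mul_pow_succ_le (a b : ℝ≥0∞) (p : ℕ) :
    a * b ^ (p + 1) ≤ 4⁻¹ * b ^ (p + 2) + 4 ^ (p + 1) * a ^ (p + 2) := by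
  rcases le_total (4 * a) b with h | h
  · refine le_trans ?_ le_self_add
    have : a ≤ 4⁻¹ * b := by
      calc a = 4⁻¹ * (4 * a) := by
            rw [← mul_assoc, ENNReal.inv_mul_cancel (by simp) (by simp), one_mul]
        _ ≤ _ := by gcongr
    calc a * b ^ (p + 1) ≤ 4⁻¹ * b * b ^ (p + 1) := by gcongr
      _ = _ := by ring
  · refine le_trans ?_ le_add_self
    calc a * b ^ (p + 1) ≤ a * (4 * a) ^ (p + 1) := by gcongr
      _ = _ := by ring

section Doob

variable {Ω : Type*} {mΩ : MeasurableSpace Ω} {μ : Measure Ω}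

/-- Integration of a weak type maximal inequality against `t ^ p`. Both sides are computed by the
layer cake formula, the right one for the measure with density `g`. -/
theorem lintegral_pow_le_two_mul_of_maximal [IsFiniteMeasure μ] {M g : Ω → ℝ≥0}
    (hM : Measurable M) (hg : Measurable g) (hgi : Integrable (fun ω => (g ω : ℝ)) μ)
    (h : ∀ t : ℝ≥0, t * μ {ω | t ≤ M ω} ≤ ENNReal.ofReal (∫ ω in {ω | t ≤ M ω}, (g ω : ℝ) ∂μ))
    (p : ℕ) :
    ∫⁻ ω, (M ω : ℝ≥0∞) ^ (p + 2) ∂μ ≤ 2 * ∫⁻ ω, (g ω : ℝ≥0∞) * (M ω : ℝ≥0∞) ^ (p + 1) ∂μ := by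
  set ν : Measure Ω := μ.withDensity fun ω => (g ω : ℝ≥0∞) with hν
  have hcoe : ∀ (κ : Measure Ω) (q : ℕ), ∫⁻ ω, (M ω : ℝ≥0∞) ^ (q + 1) ∂κ =
      ENNReal.ofReal (q + 1) *
        ∫⁻ t in Set.Ioi 0, κ {ω | t ≤ (M ω : ℝ)} * ENNReal.ofReal (t ^ q) := fun κ q => by
    have := lintegral_rpow_eq_lintegral_meas_le_mul κ (f := fun ω => (M ω : ℝ))
      (ae_of_all _ fun ω => (M ω).2) (by fun_prop) (p := (q + 1 : ℕ)) (by positivity)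
    simp only [Real.rpow_natCast, ENNReal.ofReal_pow (NNReal.coe_nonneg _),
      ENNReal.ofReal_coe_nnreal] at this
    rw [this]
    simp
  have hνg : ∫⁻ ω, (g ω : ℝ≥0∞) * (M ω : ℝ≥0∞) ^ (p + 1) ∂μ =
      ∫⁻ ω, (M ω : ℝ≥0∞) ^ (p + 1) ∂ν := by
    rw [hν, lintegral_withDensity_eq_lintegral_mul _ (by fun_prop) (by fun_prop)]
    rfl
  have hle : ∫⁻ t in Set.Ioi (0 : ℝ), μ {ω | t ≤ (M ω : ℝ)} * ENNReal.ofReal (t ^ (p + 1)) ≤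
      ∫⁻ t in Set.Ioi (0 : ℝ), ν {ω | t ≤ (M ω : ℝ)} * ENNReal.ofReal (t ^ p) := by
    refine setLIntegral_mono' measurableSet_Ioi fun t ht => ?_
    lift t to ℝ≥0 using (le_of_lt ht)
    have hs : MeasurableSet {ω | t ≤ M ω} := measurableSet_le measurable_const hM
    have h1 : ν {ω | (t : ℝ) ≤ (M ω : ℝ)} =
        ENNReal.ofReal (∫ ω in {ω | t ≤ M ω}, (g ω : ℝ) ∂μ) := by
      simp only [NNReal.coe_le_coe]
      rw [hν, withDensity_apply _ hs, ofReal_integral_eq_lintegral_ofReal hgi.integrableOn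
        (ae_of_all _ fun ω => (g ω).2)]
      simp
    rw [h1]
    refine le_trans (le_of_eq ?_) (mul_le_mul_left (h t) _)
    simp only [NNReal.coe_le_coe]
    rw [ENNReal.ofReal_pow t.coe_nonneg, ENNReal.ofReal_pow t.coe_nonneg, ENNReal.ofReal_coe_nnreal]
    ring
  have hc : ENNReal.ofReal ((p + 1 : ℕ) + 1) ≤ 2 * ENNReal.ofReal (p + 1) := by
    rw [← ENNReal.ofReal_ofNat 2, ← ENNReal.ofReal_mul (by norm_num)]
    apply ENNReal.ofReal_le_ofReal
    push_cast
    linarith [(Nat.cast_nonneg p : (0 : ℝ) ≤ p)]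
  rw [hνg, hcoe μ (p + 1), hcoe ν p, ← mul_assoc]
  exact mul_le_mul' hc hle

/-- **Doob's maximal inequality** for moments of integer order at least two of a nonnegative
submartingale. The right hand side may be infinite. -/
theorem lintegral_sup_pow_le [IsFiniteMeasure μ] {𝒢 : Filtration ℕ mΩ} {f : ℕ → Ω → ℝ≥0}
    (hf : Submartingale (fun k ω => (f k ω : ℝ)) 𝒢 μ) (p n : ℕ) :
    ∫⁻ ω, (((Finset.range (n + 1)).sup fun k => f k ω : ℝ≥0) : ℝ≥0∞) ^ (p + 2) ∂μ ≤
      4 ^ (p + 2) * ∫⁻ ω, (f n ω : ℝ≥0∞) ^ (p + 2) ∂μ := by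
  have hfm : ∀ k, Measurable (f k) := fun k => by
    have := ((hf.1 k).mono (𝒢.le k)).measurable.real_toNNReal
    simpa using this
  set M : Ω → ℝ≥0 := fun ω => (Finset.range (n + 1)).sup fun k => f k ω with hM
  have hMm : Measurable M := by
    have h : M = (Finset.range (n + 1)).sup f := by
      ext ω; simp [hM, Finset.sup_apply]
    rw [h]
    exact Finset.sup_induction measurable_const (fun _ h₁ _ h₂ => h₁.sup h₂) fun k _ => hfm k
  rcases eq_top_or_lt_top (∫⁻ ω, (f n ω : ℝ≥0∞) ^ (p + 2) ∂μ) with htop | hfin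
  · rw [htop, ENNReal.mul_top (by simp)]
    exact le_top
  have hpow : ∀ (g : Ω → ℝ≥0), eLpNorm (fun ω => (g ω : ℝ)) (p + 2 : ℕ) μ ^ (p + 2) =
      ∫⁻ ω, (g ω : ℝ≥0∞) ^ (p + 2) ∂μ := fun g => by
    have h1 := eLpNorm_nnreal_pow_eq_lintegral (μ := μ) (f := fun ω => (g ω : ℝ))
      (p := (p + 2 : ℕ)) (by positivity)
    simp only [NNReal.coe_natCast, ENNReal.rpow_natCast, ENNReal.coe_natCast] at h1
    rw [h1]
    simp
  have hmem : ∀ k ∈ Finset.range (n + 1), MemLp (fun ω => (f k ω : ℝ)) (p + 2 : ℕ) μ := by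
    intro k hk
    have hn : MemLp (fun ω => (f n ω : ℝ)) (p + 2 : ℕ) μ := by
      refine ⟨(hf.integrable n).1, ?_⟩
      by_contra hcon
      rw [not_lt, top_le_iff] at hcon
      rw [← hpow, hcon] at hfin
      simp at hfin
    refine (hn.condExp (m := 𝒢 k) (by exact_mod_cast (by omega : 1 ≤ p + 2))).mono
      (hf.integrable k).1 ?_
    filter_upwards [hf.2.1 k n (by simpa [Nat.lt_succ_iff] using hk)] with ω hω
    rw [Real.norm_of_nonneg (NNReal.coe_nonneg _)]
    exact hω.trans (le_abs_self _)
  -- Finiteness of the left hand side is needed to absorb half of it at the end.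
  have hMfin : ∫⁻ ω, (M ω : ℝ≥0∞) ^ (p + 2) ∂μ ≠ ∞ := by
    have hsum := memLp_finsetSum _ hmem
    have hMmem : MemLp (fun ω => (M ω : ℝ)) (p + 2 : ℕ) μ := by
      refine hsum.mono (by fun_prop) (ae_of_all _ fun ω => ?_)
      rw [Real.norm_of_nonneg (NNReal.coe_nonneg _), Real.norm_of_nonneg (by positivity)]
      have : M ω ≤ ∑ k ∈ Finset.range (n + 1), f k ω := Finset.sup_le fun k hk =>
        Finset.single_le_sum (f := fun k => f k ω) (fun _ _ => zero_le) hk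
      exact_mod_cast this
    rw [← hpow]
    exact ENNReal.pow_ne_top hMmem.2.ne
  have hmax : ∀ t : ℝ≥0, t * μ {ω | t ≤ M ω} ≤
      ENNReal.ofReal (∫ ω in {ω | t ≤ M ω}, (f n ω : ℝ) ∂μ) := fun t => by
    have h1 := maximal_ineq hf (fun k ω => (f k ω).2) (ε := t) n
    have h2 : ∀ ω, (Finset.range (n + 1)).sup' Finset.nonempty_range_add_one
        (fun k => (f k ω : ℝ)) = (M ω : ℝ) := fun ω => by
      simp only [hM, ← Finset.sup'_eq_sup (Finset.nonempty_range_add_one (n := n))]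
      exact (Finset.apply_sup'_eq_sup'_comp Finset.nonempty_range_add_one ((↑) : ℝ≥0 → ℝ)
        (fun a b => NNReal.coe_max a b)).symm
    simpa only [h2, NNReal.coe_le_coe] using h1
  have h1 := lintegral_pow_le_two_mul_of_maximal hMm (hfm n) (hf.integrable n) hmax p
  set I := ∫⁻ ω, (M ω : ℝ≥0∞) ^ (p + 2) ∂μ with hI
  set G := ∫⁻ ω, (f n ω : ℝ≥0∞) ^ (p + 2) ∂μ with hG
  have h2 : I ≤ 2⁻¹ * I + 2 * 4 ^ (p + 1) * G := by
    calc I ≤ 2 * ∫⁻ ω, (4⁻¹ * (M ω : ℝ≥0∞) ^ (p + 2) + 4 ^ (p + 1) * (f n ω : ℝ≥0∞) ^ (p + 2)) ∂μ :=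
          h1.trans (by gcongr with ω; exact ENNReal.mul_pow_succ_le _ _ _)
      _ = 2 * (4⁻¹ * I + 4 ^ (p + 1) * G) := by
          rw [lintegral_add_left (by fun_prop), lintegral_const_mul _ (by fun_prop),
            lintegral_const_mul _ (by fun_prop)]
      _ = 2⁻¹ * I + 2 * 4 ^ (p + 1) * G := by
          rw [mul_add, ← mul_assoc, ← mul_assoc]
          congr 2
          rw [show (4 : ℝ≥0∞) = 2 * 2 by norm_num, ENNReal.mul_inv (by simp) (by simp),
            ← mul_assoc, ENNReal.mul_inv_cancel (by simp) (by simp), one_mul]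
  have h3 : 2⁻¹ * I + 2⁻¹ * I = I := by
    rw [← add_mul, ENNReal.inv_two_add_inv_two, one_mul]
  have h4 : 2⁻¹ * I ≤ 2 * 4 ^ (p + 1) * G := by
    refine (ENNReal.add_le_add_iff_left (a := 2⁻¹ * I) (ENNReal.mul_ne_top (by simp) hMfin)).1 ?_
    rw [h3]
    exact h2
  calc I = 2 * (2⁻¹ * I) := by
        rw [← mul_assoc, ENNReal.mul_inv_cancel (by simp) (by simp), one_mul]
    _ ≤ 2 * (2 * 4 ^ (p + 1) * G) := by gcongr
    _ = 4 ^ (p + 2) * G := by ring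

variable {B : Type*} [NormedAddCommGroup B] [NormedSpace ℝ B] [CompleteSpace B]

theorem MeasureTheory.Martingale.submartingale_norm {𝒢 : Filtration ℕ mΩ} {Y : ℕ → Ω → B}
    (hY : Martingale Y 𝒢 μ) : Submartingale (fun k ω => ‖Y k ω‖) 𝒢 μ := by
  refine ⟨fun k => (hY.1 k).norm, fun i k hik => ?_, fun k => (hY.integrable k).norm⟩
  filter_upwards [norm_condExp_le (μ := μ) (m := 𝒢 i) (Y k), hY.2 i k hik] with ω h1 h2
  rwa [h2] at h1

theorem submartingale_sup_nnnorm [IsFiniteMeasure μ] {𝒢 : Filtration ℕ mΩ} {ι : Type*}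
    (J : Finset ι) {Y : ι → ℕ → Ω → B} (hY : ∀ i ∈ J, Martingale (Y i) 𝒢 μ) :
    Submartingale (fun k ω => ((J.sup fun i => ‖Y i k ω‖₊ : ℝ≥0) : ℝ)) 𝒢 μ := by
  classical
  induction J using Finset.induction_on with
  | empty => exact (martingale_zero ℝ 𝒢 μ).submartingale
  | insert a J _ ih =>
    have h1 := ((hY a (by simp)).submartingale_norm).sup
      (ih fun i hi => hY i (Finset.mem_insert_of_mem hi))
    simp only [Finset.sup_insert, NNReal.coe_max, coe_nnnorm]
    exact h1

end Doob

/-! ### Completely commuting filtrations -/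

theorem List.prod_ofFn_zpow_add {G : Type*} [Group G] {d : ℕ} {f : Fin d → G}
    (hf : ∀ q r, Commute (f q) (f r)) (i j : Fin d → ℤ) :
    (List.ofFn fun q => f q ^ (i + j) q).prod =
      (List.ofFn fun q => f q ^ i q).prod * (List.ofFn fun q => f q ^ j q).prod := by
  induction d with
  | zero => simp
  | succ d ih =>
    have h := ih (f := fun q => f q.succ) (fun q r => hf _ _) (fun q => i q.succ)
      (fun q => j q.succ)
    have hc : Commute (f 0 ^ j 0) (List.ofFn fun q : Fin d => f q.succ ^ i q.succ).prod := by
      refine Commute.list_prod_right _ _ fun g hg => ?_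
      obtain ⟨q, rfl⟩ := (List.mem_ofFn' _ _).1 hg
      exact (hf 0 q.succ).zpow_zpow _ _
    simp only [List.ofFn_succ, List.prod_cons, Pi.add_apply] at h ⊢
    rw [h, zpow_add, mul_assoc, mul_assoc, ← mul_assoc (f 0 ^ j 0), hc.eq, mul_assoc]

section Transport

variable {Ω : Type*} {m mΩ : MeasurableSpace Ω} {μ : Measure Ω}
  {B : Type*} [NormedAddCommGroup B] [NormedSpace ℝ B] [CompleteSpace B]

/-- Conditional expectations are transported by a measure preserving map `e`, which need not be
invertible. -/
theorem MeasureTheory.MeasurePreserving.condExp_comp [IsFiniteMeasure μ] {e : Ω → Ω}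
    (he : MeasurePreserving e μ μ) (hm : m ≤ mΩ) {f : Ω → B} (hf : Integrable f μ) :
    μ[f ∘ e | m.comap e] =ᵐ[μ] μ[f | m] ∘ e := by
  have hle : m.comap e ≤ mΩ :=
    (MeasurableSpace.comap_mono hm).trans he.measurable.comap_le
  have hcomp : ∀ {g : Ω → B}, Integrable g μ → ∀ {t : Set Ω}, MeasurableSet t →
      ∫ ω in e ⁻¹' t, (g ∘ e) ω ∂μ = ∫ ω in t, g ω ∂μ := fun {g} hg t ht => by
    have hg' : AEStronglyMeasurable g (μ.map e) := by rw [he.map_eq]; exact hg.1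
    have := setIntegral_map ht hg' he.measurable.aemeasurable
    rw [he.map_eq] at this
    exact this.symm
  refine (ae_eq_condExp_of_forall_setIntegral_eq hle (he.integrable_comp_of_integrable hf)
    (fun s _ _ => (he.integrable_comp_of_integrable integrable_condExp).integrableOn)
    ?_ ?_).symm
  · rintro s ⟨t, ht, rfl⟩ -
    rw [hcomp integrable_condExp (hm t ht), hcomp hf (hm t ht), setIntegral_condExp hm hf ht]
  · exact (stronglyMeasurable_condExp.comp_measurable
      (comap_measurable e)).aestronglyMeasurable

end Transport

namespace Orthomartingale

variable {Ω : Type*} {F₀ mΩ : MeasurableSpace Ω} {μ : Measure Ω} {d : ℕ} {T : Fin d → Ω ≃ᵐ Ω}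

theorem shift_zero : shift T 0 = 1 := by
  simp [shift]

namespace IsCommutingMeasurePreserving

theorem shift_add (h : IsCommutingMeasurePreserving μ T) (i j : Fin d → ℤ) :
    shift T (i + j) = shift T i * shift T j :=
  List.prod_ofFn_zpow_add (f := fun q => ((T q).toEquiv : Equiv.Perm Ω))
    (fun q r => Equiv.ext fun ω => h.commute q r ω) i j

theorem measurePreserving_shift (h : IsCommutingMeasurePreserving μ T) (i : Fin d → ℤ) :
    MeasurePreserving (shift T i) μ μ := by
  refine List.prod_induction (fun σ : Equiv.Perm Ω => MeasurePreserving σ μ μ)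
    (fun σ τ hσ hτ => hσ.comp hτ) (MeasurePreserving.id μ) fun σ hσ => ?_
  obtain ⟨q, rfl⟩ := (List.mem_ofFn' _ _).1 hσ
  have hpow : ∀ {σ : Equiv.Perm Ω}, MeasurePreserving σ μ μ → ∀ n : ℕ,
      MeasurePreserving (σ ^ n : Equiv.Perm Ω) μ μ := fun hσ n => by
    rw [← Equiv.Perm.iterate_eq_pow]
    exact hσ.iterate n
  have hq := h.measurePreserving q
  obtain ⟨n, hn | hn⟩ := Int.eq_nat_or_neg (i q)
  · simp only [hn, zpow_natCast]
    exact hpow (σ := (T q).toEquiv) hq n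
  · simp only [hn, zpow_neg, zpow_natCast, ← inv_pow]
    exact hpow (σ := (T q).toEquiv⁻¹) (hq.symm (T q)) n

theorem shiftedAlgebra_add (h : IsCommutingMeasurePreserving μ T) (i j : Fin d → ℤ) :
    shiftedAlgebra T F₀ (i + j) = (shiftedAlgebra T F₀ j).comap (shift T i) := by
  rw [shiftedAlgebra, add_comm, h.shift_add, Equiv.Perm.coe_mul, MeasurableSpace.comap_comp]

end IsCommutingMeasurePreserving

namespace IsCompletelyCommuting

theorem shiftedAlgebra_le (h : IsCompletelyCommuting μ T F₀) (i : Fin d → ℤ) :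
    shiftedAlgebra T F₀ i ≤ mΩ :=
  (MeasurableSpace.comap_mono h.le).trans
    (h.transformations.measurePreserving_shift i).measurable.comap_le

/-- As the `T q` generate `shift T (j - i)` with nonnegative exponents, the inclusions
`F₀ ≤ F₀.comap (T q)` propagate to `F₀ ≤ F₀.comap (shift T (j - i))`. -/
theorem shiftedAlgebra_mono (h : IsCompletelyCommuting μ T F₀) {i j : Fin d → ℤ} (hij : i ≤ j) :
    shiftedAlgebra T F₀ i ≤ shiftedAlgebra T F₀ j := by
  have key : F₀ ≤ F₀.comap (shift T (j - i)) := by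
    have hcomp : ∀ σ τ : Equiv.Perm Ω, F₀ ≤ F₀.comap σ → F₀ ≤ F₀.comap τ →
        F₀ ≤ F₀.comap (σ * τ : Equiv.Perm Ω) := fun σ τ hσ hτ => by
      rw [Equiv.Perm.coe_mul, ← MeasurableSpace.comap_comp]
      exact hτ.trans (MeasurableSpace.comap_mono hσ)
    have hone : F₀ ≤ F₀.comap (1 : Equiv.Perm Ω) := by
      rw [Equiv.Perm.coe_one, MeasurableSpace.comap_id]
    refine List.prod_induction (fun σ : Equiv.Perm Ω => F₀ ≤ F₀.comap σ) hcomp hone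
      fun σ hσ => ?_
    obtain ⟨q, rfl⟩ := (List.mem_ofFn' _ _).1 hσ
    obtain ⟨n, hn⟩ := Int.eq_ofNat_of_zero_le (sub_nonneg.2 (hij q))
    simp only [Pi.sub_apply, hn, zpow_natCast]
    clear hn
    induction n with
    | zero => exact hone
    | succ n ih => exact pow_succ ((T q).toEquiv : Equiv.Perm Ω) n ▸ hcomp _ _ ih (h.le_comap q)
  calc shiftedAlgebra T F₀ i ≤ (F₀.comap (shift T (j - i))).comap (shift T i) :=
        MeasurableSpace.comap_mono key
    _ = shiftedAlgebra T F₀ j := by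
        rw [← h.transformations.shiftedAlgebra_add, add_sub_cancel]

variable {B : Type*} [NormedAddCommGroup B] [NormedSpace ℝ B] [CompleteSpace B]
  [TopologicalSpace.SeparableSpace B]

/-- Complete commutation for Banach space valued functions, obtained from the real case by testing
against continuous linear functionals. -/
theorem condExp_eq_condExp_inf (h : IsCompletelyCommuting μ T F₀) (k l : Fin d → ℤ) {Y : Ω → B}
    (hY : Integrable Y μ) (hYl : StronglyMeasurable[shiftedAlgebra T F₀ l] Y) :
    μ[Y | shiftedAlgebra T F₀ k] =ᵐ[μ] μ[Y | shiftedAlgebra T F₀ (k ⊓ l)] := by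
  have := UniformSpace.secondCountable_of_separable B
  rw [← sub_ae_eq_zero]
  refine ae_eq_zero_of_forall_dual ℝ fun c => ?_
  have hc := h.condExp_inf k l (c ∘ Y) (c.integrable_comp hY)
    (c.continuous.comp_stronglyMeasurable hYl).measurable
  filter_upwards [hc, c.comp_condExp_comm (m := shiftedAlgebra T F₀ k) hY,
    c.comp_condExp_comm (m := shiftedAlgebra T F₀ (k ⊓ l)) hY] with ω h1 h2 h3
  simp only [Function.comp_apply] at h2 h3
  simp [h1, h2, h3]

theorem condExp_condExp [IsProbabilityMeasure μ] (h : IsCompletelyCommuting μ T F₀)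
    (k l : Fin d → ℤ) {Y : Ω → B} :
    μ[μ[Y | shiftedAlgebra T F₀ l] | shiftedAlgebra T F₀ k] =ᵐ[μ]
      μ[Y | shiftedAlgebra T F₀ (k ⊓ l)] :=
  (h.condExp_eq_condExp_inf k l integrable_condExp stronglyMeasurable_condExp).trans
    (condExp_condExp_of_le (h.shiftedAlgebra_mono inf_le_right) (h.shiftedAlgebra_le l))

end IsCompletelyCommuting

theorem partialSum_one {B : Type*} [AddCommMonoid B] (m : Ω → B) : partialSum T m 1 = m := by
  ext ω
  have : (Fintype.piFinset fun q : Fin d => Finset.range ((1 : Fin d → ℕ) q)) = {0} := by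
    ext i; simp [funext_iff]
  rw [partialSum, this, Finset.sum_singleton]
  simp only [Pi.zero_apply, Nat.cast_zero]
  change m (shift T 0 ω) = _
  rw [shift_zero]
  rfl

theorem partialSum_update_zero {B : Type*} [AddCommMonoid B] (m : Ω → B) (n : Fin d → ℕ)
    (q : Fin d) : partialSum T m (Function.update n q 0) = 0 := by
  ext ω
  refine Finset.sum_eq_zero fun i hi => ?_
  simpa using Fintype.mem_piFinset.1 hi q

/-- The integrable function `m` generates a field of orthomartingale differences: it is measurable
with respect to `F_(1, …, 1)` and is conditionally centered with respect to each sigma-algebra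
`F_i`, where `i` has one coordinate equal to `0` and the other ones equal to `1`. -/
structure IsOrthoDifference {B : Type*} [NormedAddCommGroup B] [NormedSpace ℝ B] [CompleteSpace B]
    (μ : Measure Ω) (T : Fin d → Ω ≃ᵐ Ω) (F₀ : MeasurableSpace Ω) (m : Ω → B) : Prop where
  integrable : Integrable m μ
  measurable : StronglyMeasurable[shiftedAlgebra T F₀ 1] m
  condExp_eq_zero : ∀ q, μ[m | shiftedAlgebra T F₀ (Function.update (1 : Fin d → ℤ) q 0)] =ᵐ[μ] 0

variable {B : Type*} [NormedAddCommGroup B] [NormedSpace ℝ B] [CompleteSpace B]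

theorem IsOrthomartingaleDifference.isOrthoDifference {m : Ω → B}
    (h : IsOrthomartingaleDifference μ T F₀ m) : IsOrthoDifference μ T F₀ m := by
  have hone : partialSum T m 1 = m := partialSum_one m
  have hcast : (fun q => (((1 : Fin d → ℕ) q : ℕ) : ℤ)) = 1 := by ext; simp
  refine ⟨hone ▸ h.integrable 1, ?_, fun q => ?_⟩
  · have := h.measurable 1
    rwa [hcast, hone] at this
  · have := h.condExp_eq (Function.update 1 q 0) 1 (by
      intro r
      rcases eq_or_ne r q with rfl | hr <;> simp [*])
    have hup : (fun r => ((Function.update (1 : Fin d → ℕ) q 0 r : ℕ) : ℤ)) =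
        Function.update (1 : Fin d → ℤ) q 0 := by
      ext r; rcases eq_or_ne r q with rfl | hr <;> simp [*]
    rwa [hone, partialSum_update_zero, hup] at this

namespace IsOrthoDifference

variable {m : Ω → B}

theorem stronglyMeasurable_comp_shift (hm : IsOrthoDifference μ T F₀ m)
    (h : IsCompletelyCommuting μ T F₀) {i k : Fin d → ℤ} (hik : i + 1 ≤ k) :
    StronglyMeasurable[shiftedAlgebra T F₀ k] fun ω => m (shift T i ω) := by
  refine StronglyMeasurable.mono ?_ (h.shiftedAlgebra_mono hik)
  rw [h.transformations.shiftedAlgebra_add]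
  exact hm.measurable.comp_measurable (comap_measurable _)

/-- Complete commutation makes `m ∘ T ^ i` centered given `F_k` as soon as a single coordinate of `k`
is at most the one of `i`, the other coordinates of `k` being arbitrarily large. -/
theorem condExp_comp_shift_eq_zero [TopologicalSpace.SeparableSpace B] [IsProbabilityMeasure μ]
    (hm : IsOrthoDifference μ T F₀ m) (h : IsCompletelyCommuting μ T F₀) {i k : Fin d → ℤ}
    {q : Fin d} (hq : k q ≤ i q) :
    μ[fun ω => m (shift T i ω) | shiftedAlgebra T F₀ k] =ᵐ[μ] 0 := by
  have hp := h.transformations.measurePreserving_shift i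
  have h1 := h.condExp_eq_condExp_inf k (i + 1) (hp.integrable_comp_of_integrable hm.integrable)
    (hm.stronglyMeasurable_comp_shift h le_rfl)
  have hle : k ⊓ (i + 1) ≤ i + Function.update (1 : Fin d → ℤ) q 0 := fun r => by
    rcases eq_or_ne r q with rfl | hr
    · simp [hq]
    · simp [hr]
  have h2 : μ[fun ω => m (shift T i ω) |
      shiftedAlgebra T F₀ (i + Function.update (1 : Fin d → ℤ) q 0)]
      =ᵐ[μ] 0 := by
    rw [h.transformations.shiftedAlgebra_add]
    refine (hp.condExp_comp (h.shiftedAlgebra_le _) hm.integrable).trans ?_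
    exact hp.quasiMeasurePreserving.ae_eq_comp (hm.condExp_eq_zero q)
  refine h1.trans ((condExp_condExp_of_le (h.shiftedAlgebra_mono hle)
    (h.shiftedAlgebra_le _)).symm.trans ((condExp_congr_ae h2).trans ?_))
  rw [condExp_zero]

end IsOrthoDifference

end Orthomartingale

/-! ### Moments of maximal partial sums -/

/-- A box of length `j + 1` in direction `q` is the union of a box of length `j` and of the translate
by `j` of a box of length one. -/
theorem sum_piFinset_range_update_succ {B : Type*} [AddCommMonoid B] {d : ℕ}
    (g : (Fin d → ℕ) → B) (n : Fin d → ℕ) (q : Fin d) (j : ℕ) :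
    ∑ i ∈ Fintype.piFinset fun r => Finset.range (Function.update n q (j + 1) r), g i =
      ∑ i ∈ Fintype.piFinset fun r => Finset.range (Function.update n q j r), g i +
        ∑ i ∈ Fintype.piFinset fun r => Finset.range (Function.update n q 1 r),
          g (i + Pi.single q j) := by
  have hmem : ∀ (k : ℕ) (i : Fin d → ℕ),
      (i ∈ Fintype.piFinset fun r => Finset.range (Function.update n q k r)) ↔
        i q < k ∧ ∀ r, r ≠ q → i r < n r := fun k i => by
    simp only [Fintype.mem_piFinset, Finset.mem_range]
    refine ⟨fun h => ⟨by simpa using h q, fun r hr => by simpa [hr] using h r⟩, fun h r => ?_⟩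
    rcases eq_or_ne r q with rfl | hr
    · simpa using h.1
    · simpa [hr] using h.2 r hr
  rw [← Finset.sum_filter_add_sum_filter_not _ fun i => i q < j]
  congr 1
  · refine Finset.sum_congr ?_ fun _ _ => rfl
    ext i
    simp only [Finset.mem_filter, hmem]
    constructor
    · rintro ⟨⟨_, h⟩, h'⟩
      exact ⟨h', h⟩
    · rintro ⟨h', h⟩
      exact ⟨⟨by omega, h⟩, h'⟩
  · refine Finset.sum_nbij' (fun i => Function.update i q 0) (fun i => i + Pi.single q j)
      ?_ ?_ ?_ ?_ ?_
    · intro i hi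
      simp only [Finset.mem_filter, hmem] at hi ⊢
      exact ⟨by simp, fun r hr => by simpa [hr] using hi.1.2 r hr⟩
    · intro i hi
      simp only [Finset.mem_filter, hmem] at hi ⊢
      refine ⟨⟨?_, fun r hr => by simpa [hr] using hi.2 r hr⟩, by simp⟩
      have := hi.1
      simp
      omega
    · intro i hi
      simp only [Finset.mem_filter, hmem] at hi
      ext r
      rcases eq_or_ne r q with rfl | hr
      · simp; omega
      · simp [hr]
    · intro i hi
      rw [hmem] at hi
      ext r
      rcases eq_or_ne r q with rfl | hr
      · simp; omega
      · simp [hr]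
    · intro i hi
      simp only [Finset.mem_filter, hmem] at hi
      congr 1
      ext r
      rcases eq_or_ne r q with rfl | hr
      · simp; omega
      · simp [hr]

namespace Orthomartingale

variable {Ω : Type*} {F₀ mΩ : MeasurableSpace Ω} {μ : Measure Ω} {d : ℕ} {T : Fin d → Ω ≃ᵐ Ω}

theorem partialSum_update_succ {B : Type*} [AddCommMonoid B]
    (h : IsCommutingMeasurePreserving μ T) (m : Ω → B)
    (n : Fin d → ℕ) (q : Fin d) (j : ℕ) (ω : Ω) :
    partialSum T m (Function.update n q (j + 1)) ω =
      partialSum T m (Function.update n q j) ω +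
        partialSum T m (Function.update n q 1) (shift T (Pi.single q (j : ℤ)) ω) := by
  simp only [partialSum]
  rw [sum_piFinset_range_update_succ
    (fun i : Fin d → ℕ => m (shift T (fun q => (i q : ℤ)) ω)) n q j]
  congr 1
  refine Finset.sum_congr rfl fun i _ => ?_
  have : (fun r => (((i + Pi.single q j : Fin d → ℕ) r : ℕ) : ℤ)) =
      (fun r => (i r : ℤ)) + Pi.single q (j : ℤ) := by
    ext r
    rcases eq_or_ne r q with rfl | hr <;> simp [*]
  rw [this, h.shift_add]
  rfl

theorem partialSum_update_eq_sum {B : Type*} [AddCommMonoid B]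
    (h : IsCommutingMeasurePreserving μ T) (m : Ω → B)
    (n : Fin d → ℕ) (q : Fin d) (j : ℕ) (ω : Ω) :
    partialSum T m (Function.update n q j) ω = ∑ a ∈ Finset.range j,
      partialSum T m (Function.update n q 1) (shift T (Pi.single q (a : ℤ)) ω) := by
  induction j with
  | zero => simp [partialSum_update_zero]
  | succ j ih => rw [partialSum_update_succ h, Finset.sum_range_succ, ih]

/-- The one-parameter filtration `(F_i)` obtained when the coordinate `q` of `i` runs through `ℕ`,
the other coordinates being those of `n`. -/
def lineFiltration (h : IsCompletelyCommuting μ T F₀) (n : Fin d → ℕ) (q : Fin d) :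
    Filtration ℕ mΩ where
  seq j := shiftedAlgebra T F₀ fun r => (Function.update n q j r : ℤ)
  mono' j k hjk := h.shiftedAlgebra_mono fun r => by
    rcases eq_or_ne r q with rfl | hr <;> simp [*]
  le' _ := h.shiftedAlgebra_le _

variable {B : Type*} [NormedAddCommGroup B] [NormedSpace ℝ B]

namespace IsOrthoDifference

variable [CompleteSpace B] {m : Ω → B}

omit [NormedSpace ℝ B] [CompleteSpace B] in
theorem memLp_partialSum (h : IsCommutingMeasurePreserving μ T) {p : ℝ≥0∞} (hmp : MemLp m p μ)
    (n : Fin d → ℕ) : MemLp (partialSum T m n) p μ :=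
  memLp_finsetSum _ fun i _ =>
    hmp.comp_measurePreserving (h.measurePreserving_shift fun q => (i q : ℤ))

theorem stronglyMeasurable_partialSum (hm : IsOrthoDifference μ T F₀ m)
    (h : IsCompletelyCommuting μ T F₀) (n : Fin d → ℕ) :
    StronglyMeasurable[shiftedAlgebra T F₀ fun q => (n q : ℤ)] (partialSum T m n) := by
  refine Finset.stronglyMeasurable_fun_sum _ fun i hi =>
    hm.stronglyMeasurable_comp_shift h fun q => ?_
  have := Fintype.mem_piFinset.1 hi q
  simp only [Finset.mem_range] at this
  simp only [Pi.add_apply, Pi.one_apply]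
  omega

theorem stronglyMeasurable_partialSum_shift (hm : IsOrthoDifference μ T F₀ m)
    (h : IsCompletelyCommuting μ T F₀) {i n : Fin d → ℕ} (hin : i ≤ n) (q : Fin d) (j : ℕ) :
    StronglyMeasurable[lineFiltration h n q (j + 1)] fun ω =>
      partialSum T m (Function.update i q 1) (shift T (Pi.single q (j : ℤ)) ω) := by
  have hle : Pi.single q (j : ℤ) + (fun r => (Function.update i q 1 r : ℤ)) ≤
      fun r => (Function.update n q (j + 1) r : ℤ) := fun r => by
    rcases eq_or_ne r q with rfl | hr
    · simp
    · simpa [hr] using hin r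
  refine StronglyMeasurable.mono ?_ (h.shiftedAlgebra_mono hle)
  rw [h.transformations.shiftedAlgebra_add]
  exact (hm.stronglyMeasurable_partialSum h _).comp_measurable (comap_measurable _)

variable [TopologicalSpace.SeparableSpace B] [IsProbabilityMeasure μ]

theorem condExp_partialSum_shift (hm : IsOrthoDifference μ T F₀ m)
    (h : IsCompletelyCommuting μ T F₀) (i n : Fin d → ℕ) (q : Fin d) (j : ℕ) :
    μ[fun ω => partialSum T m (Function.update i q 1) (shift T (Pi.single q (j : ℤ)) ω) |
      lineFiltration h n q j] =ᵐ[μ] 0 := by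
  set J := Fintype.piFinset fun r => Finset.range (Function.update i q 1 r)
  set f : (Fin d → ℕ) → Ω → B :=
    fun a ω => m (shift T ((fun r => (a r : ℤ)) + Pi.single q (j : ℤ)) ω) with hf
  have hsum : (fun ω => partialSum T m (Function.update i q 1)
      (shift T (Pi.single q (j : ℤ)) ω)) = ∑ a ∈ J, f a := by
    ext ω
    simp only [partialSum, Finset.sum_apply, hf, h.transformations.shift_add]
    rfl
  have hint : ∀ a ∈ J, Integrable (f a) μ := fun a _ =>
    (h.transformations.measurePreserving_shift _).integrable_comp_of_integrable hm.integrable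
  have hzero : ∀ a, μ[f a | lineFiltration h n q j] =ᵐ[μ] 0 := fun a =>
    hm.condExp_comp_shift_eq_zero h (q := q) (by simp)
  rw [hsum]
  filter_upwards [condExp_finsetSum hint (lineFiltration h n q j), ae_all_iff.2 hzero]
    with ω h1 h2
  rw [h1, Finset.sum_apply]
  exact Finset.sum_eq_zero fun a _ => h2 a

/-- Along each direction `q` the partial sums form a martingale. The filtration may be taken with
larger other coordinates than those of the sums, so that it is common to all sums over boxes
bounded by `n` in the directions other than `q`. -/
theorem martingale_partialSum_update (hm : IsOrthoDifference μ T F₀ m)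
    (h : IsCompletelyCommuting μ T F₀) {i n : Fin d → ℕ} (hin : i ≤ n) (q : Fin d) :
    Martingale (fun j => partialSum T m (Function.update i q j)) (lineFiltration h n q) μ := by
  have hint : ∀ k, Integrable (partialSum T m k) μ := fun k =>
    memLp_one_iff_integrable.1
      (memLp_partialSum h.transformations (memLp_one_iff_integrable.2 hm.integrable) k)
  have had : StronglyAdapted (lineFiltration h n q)
      (fun j => partialSum T m (Function.update i q j)) := fun j => by
    refine (hm.stronglyMeasurable_partialSum h _).mono (h.shiftedAlgebra_mono fun r => ?_)
    rcases eq_or_ne r q with rfl | hr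
    · simp
    · simpa [hr] using hin r
  refine martingale_nat had (fun j => hint _) fun j => ?_
  have heq : partialSum T m (Function.update i q (j + 1)) =
      partialSum T m (Function.update i q j) + fun ω =>
        partialSum T m (Function.update i q 1) (shift T (Pi.single q (j : ℤ)) ω) :=
    funext (partialSum_update_succ h.transformations m i q j)
  have hi2 : Integrable (fun ω => partialSum T m (Function.update i q 1)
      (shift T (Pi.single q (j : ℤ)) ω)) μ :=
    (h.transformations.measurePreserving_shift _).integrable_comp_of_integrable (hint _)
  filter_upwards [heq ▸ condExp_add (hint (Function.update i q j)) hi2 (lineFiltration h n q j),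
    hm.condExp_partialSum_shift h i n q j] with ω h1 h2
  rw [h1, Pi.add_apply, h2, condExp_of_stronglyMeasurable ((lineFiltration h n q).le j) (had j)
    (hint _)]
  simp

/-- Cairoli's inequality: Doob's inequality is applied successively in the directions `q ∈ Q`. The
maximum is over the boxes with sides at most `n q` for `q ∈ Q` and equal to `n q` otherwise. For
`q ∉ Q` it is, as a function of the side in direction `q`, the maximum of the norms of finitely many
martingales for a common filtration, hence a submartingale. -/
theorem lintegral_sup_partialSum_pow_le (hm : IsOrthoDifference μ T F₀ m)
    (h : IsCompletelyCommuting μ T F₀) (p : ℕ) (n : Fin d → ℕ) (Q : Finset (Fin d)) :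
    ∫⁻ ω, (((Fintype.piFinset fun q => if q ∈ Q then Finset.range (n q + 1) else {n q}).sup
        fun i => ‖partialSum T m i ω‖₊ : ℝ≥0) : ℝ≥0∞) ^ (p + 2) ∂μ ≤
      (4 ^ (p + 2)) ^ Q.card * ∫⁻ ω, ‖partialSum T m n ω‖ₑ ^ (p + 2) ∂μ := by
  induction Q using Finset.induction_on with
  | empty =>
    simp only [Finset.notMem_empty, if_false, Fintype.piFinset_singleton, Finset.sup_singleton,
      Finset.card_empty, pow_zero, one_mul, enorm_eq_nnnorm]
    exact le_rfl
  | insert q Q hq ih =>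
    set J := Fintype.piFinset fun q => if q ∈ Q then Finset.range (n q + 1) else {n q} with hJ
    have hJle : ∀ i ∈ J, i ≤ n := fun i hi r => by
      have := Fintype.mem_piFinset.1 hi r
      split_ifs at this with hr
      · simpa [Nat.lt_succ_iff] using this
      · exact (Finset.mem_singleton.1 this).le
    have hsub := submartingale_sup_nnnorm J
      fun i hi => hm.martingale_partialSum_update h (hJle i hi) q
    have hdoob := lintegral_sup_pow_le
      (f := fun k ω => J.sup fun i => ‖partialSum T m (Function.update i q k) ω‖₊) hsub p (n q)
    have hlast : ∀ ω, (J.sup fun i => ‖partialSum T m (Function.update i q (n q)) ω‖₊) =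
        J.sup fun i => ‖partialSum T m i ω‖₊ := fun ω => by
      refine Finset.sup_congr rfl fun i hi => ?_
      have := Fintype.mem_piFinset.1 hi q
      rw [if_neg hq, Finset.mem_singleton] at this
      rw [← this, Function.update_eq_self]
    simp only [hlast] at hdoob
    rw [Finset.card_insert_of_notMem hq, pow_succ', mul_assoc]
    refine le_trans (lintegral_mono fun ω => ?_) (hdoob.trans (mul_le_mul_right ih _))
    gcongr
    refine Finset.sup_le fun i hi => ?_
    have hi' := fun r => Fintype.mem_piFinset.1 hi r
    have hmem : Function.update i q (n q) ∈ J := by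
      refine Fintype.mem_piFinset.2 fun r => ?_
      rcases eq_or_ne r q with rfl | hr
      · simp [hq]
      · simpa [hr] using hi' r
    have hiq : i q ∈ Finset.range (n q + 1) := by simpa using hi' q
    refine le_trans ?_ (Finset.le_sup (f := fun k => J.sup fun i =>
      ‖partialSum T m (Function.update i q k) ω‖₊) hiq)
    refine le_trans ?_ (Finset.le_sup (f := fun i' =>
      ‖partialSum T m (Function.update i' q (i q)) ω‖₊) hmem)
    simp

theorem lintegral_maxPartialSum_pow_le (hm : IsOrthoDifference μ T F₀ m)
    (h : IsCompletelyCommuting μ T F₀) (p : ℕ) (n : Fin d → ℕ) :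
    ∫⁻ ω, (maxPartialSum T m n ω : ℝ≥0∞) ^ (p + 2) ∂μ ≤
      (4 ^ (p + 2)) ^ d * ∫⁻ ω, ‖partialSum T m n ω‖ₑ ^ (p + 2) ∂μ := by
  have hQ := hm.lintegral_sup_partialSum_pow_le h p n Finset.univ
  rw [Finset.card_univ, Fintype.card_fin] at hQ
  refine le_trans (lintegral_mono fun ω => ?_) hQ
  gcongr
  refine Finset.sup_mono fun i hi => Fintype.mem_piFinset.2 fun q => ?_
  simpa [Nat.lt_succ_iff] using (Finset.mem_Icc.1 hi).2 q

/-- The one-parameter moment inequality is applied successively in each direction: the sums over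
the slices orthogonal to `q` are martingale differences and have the same law. -/
theorem integral_partialSum_pow_le (hm : IsOrthoDifference μ T F₀ m)
    (h : IsCompletelyCommuting μ T F₀) {N : Seminorm ℝ B} (hN : Continuous N)
    {b : ℝ} (hb : ∀ x, N x ≤ b * ‖x‖) {L : ℝ} (hL : 0 ≤ L) {j : ℕ}
    (hNL : ∀ x y : B, N (x + y) ^ (2 * j + 2) + N (x - y) ^ (2 * j + 2) ≤
      2 * N x ^ (2 * j + 2) + L * (N x ^ (2 * j) * N y ^ 2 + N y ^ (2 * j + 2)))
    (hmp : MemLp m (2 * j + 2 : ℕ) μ) (n : Fin d → ℕ) :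
    ∫ ω, N (partialSum T m n ω) ^ (2 * j + 2) ∂μ ≤
      (∏ q, 2 * L * Real.exp L * (n q : ℝ) ^ (j + 1)) * ∫ ω, N (m ω) ^ (2 * j + 2) ∂μ := by
  -- Induction on the set of directions in which the box has a side greater than one.
  suffices hQ : ∀ (Q : Finset (Fin d)) (n : Fin d → ℕ), (∀ q ∉ Q, n q = 1) →
      ∫ ω, N (partialSum T m n ω) ^ (2 * j + 2) ∂μ ≤
        (∏ q ∈ Q, 2 * L * Real.exp L * (n q : ℝ) ^ (j + 1)) * ∫ ω, N (m ω) ^ (2 * j + 2) ∂μ from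
    hQ Finset.univ n (by simp)
  intro Q
  induction Q using Finset.induction_on with
  | empty =>
    intro n hn
    obtain rfl : n = 1 := funext fun q => hn q (by simp)
    simp [partialSum_one]
  | insert q Q hq ih =>
    intro n hn
    have hS := memLp_partialSum (T := T) h.transformations hmp (Function.update n q 1)
    have hX : ∀ a : ℕ, ∫ ω, N (partialSum T m (Function.update n q 1)
        (shift T (Pi.single q (a : ℤ)) ω)) ^ (2 * j + 2) ∂μ =
        ∫ ω, N (partialSum T m (Function.update n q 1) ω) ^ (2 * j + 2) ∂μ := fun a => by
      have hp := h.transformations.measurePreserving_shift (Pi.single q (a : ℤ))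
      conv_rhs => rw [← hp.map_eq]
      rw [integral_map hp.measurable.aemeasurable]
      rw [hp.map_eq]
      exact (hN.pow _).comp_aestronglyMeasurable hS.1
    have key := Seminorm.integral_sum_pow_le hN hb hL hNL (ℱ := lineFiltration h n q)
      (X := fun a ω => partialSum T m (Function.update n q 1) (shift T (Pi.single q (a : ℤ)) ω))
      (fun a => hm.stronglyMeasurable_partialSum_shift h le_rfl q a)
      (fun a => hS.comp_measurePreserving (h.transformations.measurePreserving_shift _))
      (fun a => hm.condExp_partialSum_shift h n n q a) (fun a => (hX a).le) (n q)
    simp only [← partialSum_update_eq_sum h.transformations m n q (n q),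
      Function.update_eq_self] at key
    have hQ := ih (Function.update n q 1) fun r hr => by
      rcases eq_or_ne r q with rfl | hrq
      · simp
      · simpa [hrq] using hn r (by simp [hrq, hr])
    have hprod : ∏ r ∈ Q, 2 * L * Real.exp L * (Function.update n q 1 r : ℝ) ^ (j + 1) =
        ∏ r ∈ Q, 2 * L * Real.exp L * (n r : ℝ) ^ (j + 1) :=
      Finset.prod_congr rfl fun r hr => by
        rw [Function.update_of_ne (ne_of_mem_of_not_mem hr hq)]
    rw [hprod] at hQ
    rw [Finset.prod_insert hq]
    calc _ ≤ _ := key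
      _ ≤ 2 * L * Real.exp L * ((n q : ℝ) ^ (j + 1) *
          ((∏ r ∈ Q, 2 * L * Real.exp L * (n r : ℝ) ^ (j + 1)) *
            ∫ ω, N (m ω) ^ (2 * j + 2) ∂μ)) := by gcongr
      _ = _ := by ring

end IsOrthoDifference

/-- The maximal partial sum over boxes of volume at most `V` has moment of order `p = 2 * j + 2` at
most a constant times `V ^ (p / 2)` times that of `m`, with a constant that depends only on `p`, on
`d` and on the space. Both moments may be infinite. -/
theorem exists_lintegral_maxPartialSum_pow_le [CompleteSpace B]
    [TopologicalSpace.SeparableSpace B] (hB : IsSmoothSpace B 2) (d j : ℕ) :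
    ∃ C : ℝ≥0, ∀ {Ω : Type*} {F₀ _mΩ : MeasurableSpace Ω} {μ : Measure Ω}
      {T : Fin d → Ω ≃ᵐ Ω} {m : Ω → B}, IsProbabilityMeasure μ → IsCompletelyCommuting μ T F₀ →
      IsOrthoDifference μ T F₀ m → ∀ n : Fin d → ℕ, 1 ≤ n →
      ∫⁻ ω, (maxPartialSum T m n ω : ℝ≥0∞) ^ (2 * j + 2) ∂μ ≤
        C * (∏ q, (n q : ℝ≥0∞)) ^ (j + 1) * ∫⁻ ω, ‖m ω‖ₑ ^ (2 * j + 2) ∂μ := by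
  obtain ⟨N, ⟨a, b, ha, hb, hab⟩, K, hK⟩ := hB
  obtain ⟨L, hL, hNL⟩ := Seminorm.add_pow_add_sub_pow_le hK (2 * j)
  have hN : Continuous N := by
    refine Seminorm.continuous_of_le (q := b.toNNReal • normSeminorm ℝ B)
      (continuous_norm.const_smul b.toNNReal) fun x => ?_
    change N x ≤ b.toNNReal * ‖x‖
    rw [Real.coe_toNNReal _ hb.le]
    exact (hab x).2
  set A : ℝ := a⁻¹ ^ (2 * j + 2) * (2 * L * Real.exp L) ^ d * b ^ (2 * j + 2) with hA
  refine ⟨(4 ^ (2 * j + 2)) ^ d * (A.toNNReal + 1), ?_⟩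
  intro Ω F₀ _mΩ μ T m hμ h hm n hn
  have hn0 : ∏ q, (n q : ℝ≥0∞) ≠ 0 := Finset.prod_ne_zero_iff.2 fun q _ => by
    exact_mod_cast (Nat.one_le_iff_ne_zero.1 (hn q))
  refine (hm.lintegral_maxPartialSum_pow_le h (2 * j) n).trans ?_
  push_cast
  rw [mul_assoc, mul_assoc]
  refine mul_le_mul_right ?_ _
  rcases eq_top_or_lt_top (∫⁻ ω, ‖m ω‖ₑ ^ (2 * j + 2) ∂μ) with htop | hfin
  · rw [htop, ENNReal.mul_top (pow_ne_zero _ hn0), ENNReal.mul_top (by simp)]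
    exact le_top
  have hmp : MemLp m (2 * j + 2 : ℕ) μ := by
    refine ⟨hm.integrable.1, ?_⟩
    rw [eLpNorm_lt_top_iff_lintegral_rpow_enorm_lt_top (by simp) (ENNReal.natCast_ne_top _),
      ENNReal.toReal_natCast]
    simpa only [ENNReal.rpow_natCast] using hfin
  have h1 := hm.integral_partialSum_pow_le h hN (fun x => (hab x).2) hL hNL hmp n
  have hS := Seminorm.integrable_comp_pow hN (fun x => (hab x).2)
    (IsOrthoDifference.memLp_partialSum (T := T) h.transformations hmp n)
  have h2 : ∫ ω, N (m ω) ^ (2 * j + 2) ∂μ ≤ b ^ (2 * j + 2) * ∫ ω, ‖m ω‖ ^ (2 * j + 2) ∂μ := by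
    rw [← integral_const_mul]
    refine integral_mono (Seminorm.integrable_comp_pow hN (fun x => (hab x).2) hmp)
      (hmp.integrable_norm_pow'.const_mul _) fun ω => ?_
    change N (m ω) ^ (2 * j + 2) ≤ b ^ (2 * j + 2) * ‖m ω‖ ^ (2 * j + 2)
    rw [← mul_pow]
    exact pow_le_pow_left₀ (apply_nonneg N _) (hab _).2 _
  have h3 : ENNReal.ofReal (∫ ω, ‖m ω‖ ^ (2 * j + 2) ∂μ) = ∫⁻ ω, ‖m ω‖ₑ ^ (2 * j + 2) ∂μ := by
    rw [ofReal_integral_eq_lintegral_ofReal hmp.integrable_norm_pow'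
      (ae_of_all _ fun ω => by positivity)]
    simp only [ENNReal.ofReal_pow (norm_nonneg _), ofReal_norm]
  have h4 : ∫⁻ ω, ‖partialSum T m n ω‖ₑ ^ (2 * j + 2) ∂μ ≤
      ENNReal.ofReal (a⁻¹ ^ (2 * j + 2) * ∫ ω, N (partialSum T m n ω) ^ (2 * j + 2) ∂μ) := by
    rw [← integral_const_mul, ofReal_integral_eq_lintegral_ofReal (hS.const_mul _)
      (ae_of_all _ fun ω => mul_nonneg (by positivity) (pow_nonneg (apply_nonneg N _) _))]
    refine lintegral_mono fun ω => ?_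
    rw [← ofReal_norm, ← ENNReal.ofReal_pow (norm_nonneg _), ← mul_pow]
    refine ENNReal.ofReal_le_ofReal (pow_le_pow_left₀ (norm_nonneg _) ?_ _)
    rw [inv_mul_eq_div, le_div_iff₀ ha, mul_comm]
    exact (hab _).1
  calc ∫⁻ ω, ‖partialSum T m n ω‖ₑ ^ (2 * j + 2) ∂μ
      ≤ ENNReal.ofReal (a⁻¹ ^ (2 * j + 2) * ((∏ q, 2 * L * Real.exp L * (n q : ℝ) ^ (j + 1)) *
          (b ^ (2 * j + 2) * ∫ ω, ‖m ω‖ ^ (2 * j + 2) ∂μ))) := by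
        refine h4.trans (ENNReal.ofReal_le_ofReal ?_)
        gcongr
        exact h1.trans (by gcongr)
    _ = ENNReal.ofReal (A * (∏ q, (n q : ℝ)) ^ (j + 1) * ∫ ω, ‖m ω‖ ^ (2 * j + 2) ∂μ) := by
        rw [Finset.prod_mul_distrib, Finset.prod_pow, Finset.prod_const, Finset.card_univ,
          Fintype.card_fin, hA]
        congr 1
        ring
    _ = ENNReal.ofReal A * ((∏ q, (n q : ℝ≥0∞)) ^ (j + 1) *
          ∫⁻ ω, ‖m ω‖ₑ ^ (2 * j + 2) ∂μ) := by
        rw [ENNReal.ofReal_mul (by positivity), ENNReal.ofReal_mul (by positivity), h3,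
          ENNReal.ofReal_pow (by positivity), ENNReal.ofReal_prod_of_nonneg fun q _ => by positivity]
        simp only [ENNReal.ofReal_natCast, mul_assoc]
    _ ≤ _ := by
        gcongr
        exact le_self_add

end Orthomartingale

/-! ### Truncation and centering -/

namespace Orthomartingale

variable {Ω : Type*} {F₀ mΩ : MeasurableSpace Ω} {μ : Measure Ω} {d : ℕ} {T : Fin d → Ω ≃ᵐ Ω}
  {B : Type*} [NormedAddCommGroup B] [NormedSpace ℝ B] [CompleteSpace B]

/-- The composition over the directions `q` in the list of the operators
`Y ↦ Y - E[Y | F_i]`, where `i` has `q`-th coordinate `0` and other coordinates `1`. -/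
noncomputable def centering {Ω : Type*} {mΩ : MeasurableSpace Ω} (μ : Measure Ω) {d : ℕ}
    (T : Fin d → Ω ≃ᵐ Ω) (F₀ : MeasurableSpace Ω) : List (Fin d) → (Ω → B) → Ω → B
  | [], Y => Y
  | q :: l, Y => centering μ T F₀ l Y -
      μ[centering μ T F₀ l Y | shiftedAlgebra T F₀ (Function.update (1 : Fin d → ℤ) q 0)]

section Centering

variable {Y Z : Ω → B} (l : List (Fin d))

theorem integrable_centering (hY : Integrable Y μ) : Integrable (centering μ T F₀ l Y) μ := by
  induction l with
  | nil => exact hY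
  | cons q l ih => exact ih.sub integrable_condExp

omit [CompleteSpace B] in
theorem stronglyMeasurable_centering (h : IsCompletelyCommuting μ T F₀)
    (hY : StronglyMeasurable[shiftedAlgebra T F₀ 1] Y) :
    StronglyMeasurable[shiftedAlgebra T F₀ 1] (centering μ T F₀ l Y) := by
  induction l with
  | nil => exact hY
  | cons q l ih =>
    refine ih.sub (stronglyMeasurable_condExp.mono (h.shiftedAlgebra_mono fun r => ?_))
    rcases eq_or_ne r q with rfl | hr <;> simp [*]

/-- Complete commutation ensures that centering in one direction preserves the centering already
achieved in the other directions. -/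
theorem condExp_centering_eq_zero [TopologicalSpace.SeparableSpace B] [IsProbabilityMeasure μ]
    (h : IsCompletelyCommuting μ T F₀) (hY : Integrable Y μ) {q : Fin d} (hq : q ∈ l) :
    μ[centering μ T F₀ l Y | shiftedAlgebra T F₀ (Function.update (1 : Fin d → ℤ) q 0)]
      =ᵐ[μ] 0 := by
  induction l with
  | nil => simp at hq
  | cons r l ih =>
    have hi := integrable_centering (T := T) (F₀ := F₀) l hY
    have hsub := condExp_sub hi integrable_condExp (μ := μ)
      (g := μ[centering μ T F₀ l Y | shiftedAlgebra T F₀ (Function.update (1 : Fin d → ℤ) r 0)])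
      (shiftedAlgebra T F₀ (Function.update (1 : Fin d → ℤ) q 0))
    have hcc := h.condExp_condExp (Function.update (1 : Fin d → ℤ) q 0)
      (Function.update (1 : Fin d → ℤ) r 0) (Y := centering μ T F₀ l Y)
    rcases eq_or_ne q r with rfl | hqr
    · rw [inf_idem] at hcc
      filter_upwards [hsub, hcc] with ω h1 h2
      simp only [centering]
      rw [h1, Pi.sub_apply, h2, sub_self, Pi.zero_apply]
    · have hzero := ih ((List.mem_cons.1 hq).resolve_left hqr)
      have hinf := (condExp_condExp_of_le (h.shiftedAlgebra_mono
        (inf_le_left (a := Function.update (1 : Fin d → ℤ) q 0)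
          (b := Function.update (1 : Fin d → ℤ) r 0)))
        (h.shiftedAlgebra_le _)).symm.trans (condExp_congr_ae hzero)
      rw [condExp_zero] at hinf
      filter_upwards [hsub, hcc, hzero, hinf] with ω h1 h2 h3 h4
      simp only [centering]
      rw [h1, Pi.sub_apply, h2, h3, h4]
      simp

theorem IsCompletelyCommuting.isOrthoDifference_centering [TopologicalSpace.SeparableSpace B]
    [IsProbabilityMeasure μ] (h : IsCompletelyCommuting μ T F₀) (hY : Integrable Y μ)
    (hYm : StronglyMeasurable[shiftedAlgebra T F₀ 1] Y) :
    IsOrthoDifference μ T F₀ (centering μ T F₀ (List.finRange d) Y) :=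
  ⟨integrable_centering _ hY, stronglyMeasurable_centering _ h hYm,
    fun q => condExp_centering_eq_zero _ h hY (List.mem_finRange q)⟩

theorem centering_add (hY : Integrable Y μ) (hZ : Integrable Z μ) :
    centering μ T F₀ l (Y + Z) =ᵐ[μ] centering μ T F₀ l Y + centering μ T F₀ l Z := by
  induction l with
  | nil => exact EventuallyEq.rfl
  | cons q l ih =>
    filter_upwards [ih, (condExp_congr_ae ih).trans (condExp_add (integrable_centering l hY)
      (integrable_centering l hZ)
      (shiftedAlgebra T F₀ (Function.update (1 : Fin d → ℤ) q 0)))] with ω h1 h2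
    simp only [centering, Pi.sub_apply, Pi.add_apply, h1, h2]
    abel

theorem IsOrthoDifference.centering_ae_eq (hY : IsOrthoDifference μ T F₀ Y) :
    centering μ T F₀ l Y =ᵐ[μ] Y := by
  induction l with
  | nil => exact EventuallyEq.rfl
  | cons q l ih =>
    filter_upwards [ih, (condExp_congr_ae ih).trans (hY.condExp_eq_zero q)] with ω h1 h2
    simp only [centering, Pi.sub_apply, h1, h2, Pi.zero_apply, sub_zero]

theorem eLpNorm_centering_le (hY : Integrable Y μ) {p : ℝ≥0∞} (hp : 1 ≤ p) :
    eLpNorm (centering μ T F₀ l Y) p μ ≤ 2 ^ l.length * eLpNorm Y p μ := by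
  induction l with
  | nil => simp [centering]
  | cons q l ih =>
    refine (eLpNorm_sub_le (integrable_centering l hY).1 integrable_condExp.1 hp).trans ?_
    calc _ ≤ eLpNorm (centering μ T F₀ l Y) p μ + eLpNorm (centering μ T F₀ l Y) p μ := by
          gcongr
          exact eLpNorm_condExp_le_eLpNorm _ hp
      _ = 2 * eLpNorm (centering μ T F₀ l Y) p μ := (two_mul _).symm
      _ ≤ 2 * (2 ^ l.length * eLpNorm Y p μ) := by gcongr
      _ = _ := by rw [List.length_cons, pow_succ']; ring

theorem lintegral_centering_pow_le (hY : Integrable Y μ) {p : ℕ} (hp : 1 ≤ p) :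
    ∫⁻ ω, ‖centering μ T F₀ l Y ω‖ₑ ^ p ∂μ ≤
      (2 ^ l.length) ^ p * ∫⁻ ω, ‖Y ω‖ₑ ^ p ∂μ := by
  have hpow : ∀ f : Ω → B, eLpNorm f p μ ^ p = ∫⁻ ω, ‖f ω‖ₑ ^ p ∂μ := fun f => by
    have h1 := eLpNorm_nnreal_pow_eq_lintegral (μ := μ) (f := f) (p := p)
      (by exact_mod_cast (Nat.one_le_iff_ne_zero.1 hp))
    simpa only [NNReal.coe_natCast, ENNReal.rpow_natCast, ENNReal.coe_natCast] using h1
  rw [← hpow, ← hpow, ← mul_pow]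
  gcongr
  exact eLpNorm_centering_le l hY (by exact_mod_cast hp)

end Centering

omit [NormedSpace ℝ B] [CompleteSpace B] in
theorem maxPartialSum_add_le (m m' : Ω → B) (n : Fin d → ℕ) (ω : Ω) :
    maxPartialSum T (m + m') n ω ≤ maxPartialSum T m n ω + maxPartialSum T m' n ω := by
  refine Finset.sup_le fun i hi => ?_
  have hadd : partialSum T (m + m') i ω = partialSum T m i ω + partialSum T m' i ω :=
    Finset.sum_add_distrib
  rw [hadd]
  exact (nnnorm_add_le _ _).trans (add_le_add
    (Finset.le_sup (f := fun i => ‖partialSum T m i ω‖₊) hi)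
    (Finset.le_sup (f := fun i => ‖partialSum T m' i ω‖₊) hi))

omit [NormedSpace ℝ B] [CompleteSpace B] in
theorem maxPartialSum_congr_ae (h : IsCommutingMeasurePreserving μ T) {m m' : Ω → B}
    (hm : m =ᵐ[μ] m') (n : Fin d → ℕ) : maxPartialSum T m n =ᵐ[μ] maxPartialSum T m' n := by
  have hall : ∀ᵐ ω ∂μ, ∀ i : Fin d → ℤ, m (shift T i ω) = m' (shift T i ω) :=
    ae_all_iff.2 fun i => (h.measurePreserving_shift i).quasiMeasurePreserving.ae_eq_comp hm
  filter_upwards [hall] with ω hω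
  simp only [maxPartialSum, partialSum, hω]

omit [NormedSpace ℝ B] [CompleteSpace B] in
theorem aemeasurable_maxPartialSum (h : IsCommutingMeasurePreserving μ T) {m : Ω → B}
    (hm : AEStronglyMeasurable m μ) (n : Fin d → ℕ) : AEMeasurable (maxPartialSum T m n) μ := by
  have heq : maxPartialSum T m n = (Finset.Icc 1 n).sup fun i ω => ‖partialSum T m i ω‖₊ := by
    ext ω
    simp [maxPartialSum, Finset.sup_apply]
  rw [heq]
  refine Finset.sup_induction (p := fun f : Ω → ℝ≥0 => AEMeasurable f μ) aemeasurable_const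
    (fun _ h₁ _ h₂ => h₁.sup h₂) fun i _ => ?_
  refine (AEStronglyMeasurable.aemeasurable (AEStronglyMeasurable.nnnorm ?_))
  exact Finset.aestronglyMeasurable_fun_sum _ fun i _ =>
    hm.comp_measurePreserving (h.measurePreserving_shift fun q => (i q : ℤ))

/-- Markov's inequality for the maximal partial sum of a centered field, at the level `V * x / 2`,
where `V` is the volume of the box. The right hand side is written in terms of `y = V ^ (1 / 2) * x`
and of the function `Y` before centering. -/
theorem exists_measure_maxPartialSum_centering_le [TopologicalSpace.SeparableSpace B]
    (hB : IsSmoothSpace B 2) (d j : ℕ) :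
    ∃ C : ℝ≥0, ∀ {Ω : Type*} {F₀ _mΩ : MeasurableSpace Ω} {μ : Measure Ω}
      {T : Fin d → Ω ≃ᵐ Ω} {Y : Ω → B}, IsProbabilityMeasure μ → IsCompletelyCommuting μ T F₀ →
      Integrable Y μ → StronglyMeasurable[shiftedAlgebra T F₀ 1] Y →
      ∀ n : Fin d → ℕ, 1 ≤ n → ∀ x y : ℝ, 0 < x → 0 < y → y ^ 2 = (∏ q, (n q : ℝ)) * x ^ 2 →
      μ {ω | (∏ q, (n q : ℝ)) * x / 2 <
          maxPartialSum T (centering μ T F₀ (List.finRange d) Y) n ω} ≤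
        C * ((ENNReal.ofReal y ^ (2 * j + 2))⁻¹ * ∫⁻ ω, ‖Y ω‖ₑ ^ (2 * j + 2) ∂μ) := by
  obtain ⟨C, hC⟩ := exists_lintegral_maxPartialSum_pow_le hB d j
  refine ⟨2 ^ (2 * j + 2) * C * (2 ^ d) ^ (2 * j + 2), ?_⟩
  intro Ω F₀ _mΩ μ T Y hμ h hY hYm n hn x y hx hy hxy
  set V : ℝ := ∏ q, (n q : ℝ) with hV
  have hV0 : 0 < V := Finset.prod_pos fun q _ => by exact_mod_cast hn q
  have hVE : ∏ q, (n q : ℝ≥0∞) = ENNReal.ofReal V := by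
    rw [hV, ENNReal.ofReal_prod_of_nonneg fun q _ => by positivity]
    simp
  have hm := h.isOrthoDifference_centering hY hYm
  have h1 := hC hμ h hm n hn
  have h2 := lintegral_centering_pow_le (T := T) (F₀ := F₀) (List.finRange d) hY
    (p := 2 * j + 2) (by omega)
  rw [List.length_finRange] at h2
  have hMm := aemeasurable_maxPartialSum h.transformations hm.integrable.1 n
  set M := maxPartialSum T (centering μ T F₀ (List.finRange d) Y) n with hM
  set I := ∫⁻ ω, ‖Y ω‖ₑ ^ (2 * j + 2) ∂μ with hI
  have hmarkov : ENNReal.ofReal (V * x / 2) ^ (2 * j + 2) * μ {ω | V * x / 2 < M ω} ≤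
      ∫⁻ ω, (M ω : ℝ≥0∞) ^ (2 * j + 2) ∂μ := by
    refine le_trans ?_ (mul_meas_ge_le_lintegral₀ (by fun_prop)
      (ENNReal.ofReal (V * x / 2) ^ (2 * j + 2)))
    refine mul_le_mul_right (measure_mono fun ω hω => ?_) _
    have hω' : V * x / 2 < M ω := hω
    have hle : ENNReal.ofReal (V * x / 2) ≤ M ω := by
      rw [← ENNReal.ofReal_coe_nnreal]
      exact ENNReal.ofReal_le_ofReal hω'.le
    exact pow_le_pow_left' hle (2 * j + 2)
  -- The level `V * x` has `p`-th power `V ^ (p / 2) * y ^ p`.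
  have hpow : (2 : ℝ≥0∞) ^ (2 * j + 2) * ENNReal.ofReal (V * x / 2) ^ (2 * j + 2) =
      ENNReal.ofReal V ^ (j + 1) * ENNReal.ofReal y ^ (2 * j + 2) := by
    rw [← mul_pow, ← ENNReal.ofReal_ofNat 2, ← ENNReal.ofReal_mul (by norm_num),
      ← ENNReal.ofReal_pow (by positivity), ← ENNReal.ofReal_pow (by positivity),
      ← ENNReal.ofReal_pow (by positivity), ← ENNReal.ofReal_mul (by positivity)]
    congr 1
    calc (2 * (V * x / 2)) ^ (2 * j + 2) = V ^ (j + 1) * (V * x ^ 2) ^ (j + 1) := by ring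
      _ = V ^ (j + 1) * y ^ (2 * j + 2) := by rw [← hxy]; ring
  have hVne : ENNReal.ofReal V ^ (j + 1) ≠ 0 := pow_ne_zero _ (by simpa using hV0)
  have hVtop : ENNReal.ofReal V ^ (j + 1) ≠ ∞ := ENNReal.pow_ne_top (by simp)
  have hyne : ENNReal.ofReal y ^ (2 * j + 2) ≠ 0 := pow_ne_zero _ (by simpa using hy)
  have hytop : ENNReal.ofReal y ^ (2 * j + 2) ≠ ∞ := ENNReal.pow_ne_top (by simp)
  have hfinal : ENNReal.ofReal y ^ (2 * j + 2) * μ {ω | V * x / 2 < M ω} ≤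
      2 ^ (2 * j + 2) * C * (2 ^ d) ^ (2 * j + 2) * I := by
    refine (ENNReal.mul_le_mul_iff_right hVne hVtop).1 ?_
    calc ENNReal.ofReal V ^ (j + 1) * (ENNReal.ofReal y ^ (2 * j + 2) * μ {ω | V * x / 2 < M ω})
        = 2 ^ (2 * j + 2) * (ENNReal.ofReal (V * x / 2) ^ (2 * j + 2) *
            μ {ω | V * x / 2 < M ω}) := by rw [← mul_assoc, ← hpow, mul_assoc]
      _ ≤ 2 ^ (2 * j + 2) * (C * ENNReal.ofReal V ^ (j + 1) *
            ((2 ^ d) ^ (2 * j + 2) * I)) := by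
          refine mul_le_mul_right (hmarkov.trans (h1.trans ?_)) _
          rw [hVE]
          gcongr
      _ = _ := by ring
  calc μ {ω | V * x / 2 < M ω} ≤ (2 ^ (2 * j + 2) * C * (2 ^ d) ^ (2 * j + 2) * I) /
        ENNReal.ofReal y ^ (2 * j + 2) := by
        rw [ENNReal.le_div_iff_mul_le (Or.inl hyne) (Or.inl hytop), mul_comm]
        exact hfinal
    _ = _ := by
        push_cast
        rw [ENNReal.div_eq_inv_mul]
        ring

/-- The maximal partial sum at the level `V * x` is controlled by a truncated moment of high order
and a truncated second moment, `m` being truncated at the level `y = V ^ (1 / 2) * x`. As truncation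
destroys the orthomartingale property, both parts of `m` are centered again; the sum of the centered
parts is still `m`, because centering is linear and leaves `m` unchanged. -/
theorem exists_measure_maxPartialSum_le [TopologicalSpace.SeparableSpace B]
    (hB : IsSmoothSpace B 2) (d j : ℕ) :
    ∃ C : ℝ≥0, ∀ {Ω : Type*} {F₀ _mΩ : MeasurableSpace Ω} {μ : Measure Ω}
      {T : Fin d → Ω ≃ᵐ Ω} {m : Ω → B}, IsProbabilityMeasure μ → IsCompletelyCommuting μ T F₀ →
      IsOrthoDifference μ T F₀ m →
      ∀ n : Fin d → ℕ, 1 ≤ n → ∀ x y : ℝ, 0 < x → 0 < y → y ^ 2 = (∏ q, (n q : ℝ)) * x ^ 2 →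
      μ {ω | (∏ q, (n q : ℝ)) * x < maxPartialSum T m n ω} ≤
        C * ((ENNReal.ofReal y ^ (2 * j + 2))⁻¹ * ∫⁻ ω in {ω | ‖m ω‖ ≤ y}, ‖m ω‖ₑ ^ (2 * j + 2) ∂μ
          + (ENNReal.ofReal y ^ 2)⁻¹ * ∫⁻ ω in {ω | y < ‖m ω‖}, ‖m ω‖ₑ ^ 2 ∂μ) := by
  obtain ⟨C₁, hC₁⟩ := exists_measure_maxPartialSum_centering_le hB d j
  obtain ⟨C₂, hC₂⟩ := exists_measure_maxPartialSum_centering_le hB d 0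
  refine ⟨max C₁ C₂, ?_⟩
  intro Ω F₀ _mΩ μ T m hμ h hm n hn x y hx hy hxy
  have hnorm : StronglyMeasurable[shiftedAlgebra T F₀ 1] fun ω => ‖m ω‖ := hm.measurable.norm
  have hs₁ : MeasurableSet[shiftedAlgebra T F₀ 1] {ω | ‖m ω‖ ≤ y} :=
    hnorm.measurable measurableSet_Iic
  have hs₂ : MeasurableSet[shiftedAlgebra T F₀ 1] {ω | y < ‖m ω‖} :=
    hnorm.measurable measurableSet_Ioi
  have hle := h.shiftedAlgebra_le 1
  set m₁ : Ω → B := {ω | ‖m ω‖ ≤ y}.indicator m with hm₁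
  set m₂ : Ω → B := {ω | y < ‖m ω‖}.indicator m with hm₂
  have hi₁ : Integrable m₁ μ := hm.integrable.indicator (hle _ hs₁)
  have hi₂ : Integrable m₂ μ := hm.integrable.indicator (hle _ hs₂)
  have hadd : m₁ + m₂ = m := by
    ext ω
    rcases le_or_gt ‖m ω‖ y with hω | hω
    · simp [hm₁, hm₂, hω]
    · simp [hm₁, hm₂, hω]
  have hlint : ∀ (s : Set Ω) (p : ℕ), p ≠ 0 → MeasurableSet s →
      ∫⁻ ω, ‖s.indicator m ω‖ₑ ^ p ∂μ = ∫⁻ ω in s, ‖m ω‖ₑ ^ p ∂μ := fun s p hp hs => by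
    rw [← lintegral_indicator hs]
    refine lintegral_congr fun ω => ?_
    by_cases hω : ω ∈ s <;> simp [hω, hp]
  have h₁ := hC₁ hμ h hi₁ (hm.measurable.indicator hs₁) n hn x y hx hy hxy
  have h₂ := hC₂ hμ h hi₂ (hm.measurable.indicator hs₂) n hn x y hx hy hxy
  rw [hm₁, hlint _ _ (by omega) (hle _ hs₁), ← hm₁] at h₁
  rw [hm₂, hlint _ _ (by omega) (hle _ hs₂), ← hm₂] at h₂
  have hae : m =ᵐ[μ] centering μ T F₀ (List.finRange d) m₁ +
      centering μ T F₀ (List.finRange d) m₂ := by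
    refine (hm.centering_ae_eq (List.finRange d)).symm.trans ?_
    conv_lhs => rw [← hadd]
    exact centering_add _ hi₁ hi₂
  have hsub : μ {ω | (∏ q, (n q : ℝ)) * x < maxPartialSum T m n ω} ≤
      μ ({ω | (∏ q, (n q : ℝ)) * x / 2 <
          maxPartialSum T (centering μ T F₀ (List.finRange d) m₁) n ω} ∪
        {ω | (∏ q, (n q : ℝ)) * x / 2 <
          maxPartialSum T (centering μ T F₀ (List.finRange d) m₂) n ω}) := by
    refine measure_mono_ae ?_
    filter_upwards [maxPartialSum_congr_ae h.transformations hae n] with ω hω hlt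
    change (∏ q, (n q : ℝ)) * x < maxPartialSum T m n ω at hlt
    have hle' : (maxPartialSum T m n ω : ℝ) ≤
        maxPartialSum T (centering μ T F₀ (List.finRange d) m₁) n ω +
          maxPartialSum T (centering μ T F₀ (List.finRange d) m₂) n ω := by
      rw [hω]
      exact_mod_cast maxPartialSum_add_le _ _ n ω
    by_contra hcon
    have hc₁ : ¬ (∏ q, (n q : ℝ)) * x / 2 <
        maxPartialSum T (centering μ T F₀ (List.finRange d) m₁) n ω := fun hh => hcon (Or.inl hh)
    have hc₂ : ¬ (∏ q, (n q : ℝ)) * x / 2 <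
        maxPartialSum T (centering μ T F₀ (List.finRange d) m₂) n ω := fun hh => hcon (Or.inr hh)
    linarith
  refine hsub.trans ((measure_union_le _ _).trans ((add_le_add h₁ h₂).trans ?_))
  rw [mul_add]
  gcongr
  · exact le_max_left _ _
  · exact le_max_right _ _

end Orthomartingale

/-! ### Dyadic decomposition of truncated moments -/

/-- The weight `2 ^ p * ρ ^ |k|`, where `ρ = max (2 ^ (s - p)) (2 ^ (2 - s))` is less than one for
`2 < s < p`. -/
noncomputable def dyadicWeight (s : ℝ) (p : ℕ) (k : ℤ) : ℝ :=
  2 ^ p * max ((2 : ℝ) ^ (s - p)) ((2 : ℝ) ^ (2 - s)) ^ k.natAbs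

theorem dyadicWeight_nonneg (s : ℝ) (p : ℕ) (k : ℤ) : 0 ≤ dyadicWeight s p k := by
  unfold dyadicWeight; positivity

theorem tsum_dyadicWeight_ne_top {s : ℝ} {p : ℕ} (hs : 2 < s) (hp : s < p) :
    ∑' k : ℤ, ENNReal.ofReal (dyadicWeight s p k) ≠ ∞ := by
  have h1 : max ((2 : ℝ) ^ (s - p)) ((2 : ℝ) ^ (2 - s)) < 1 :=
    max_lt (Real.rpow_lt_one_of_one_lt_of_neg (by norm_num) (by linarith))
      (Real.rpow_lt_one_of_one_lt_of_neg (by norm_num) (by linarith))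
  have hsum : Summable (dyadicWeight s p) := by
    refine Summable.mul_left _ (Summable.of_nat_of_neg ?_ ?_) <;>
    simpa using summable_geometric_of_lt_one (by positivity) h1
  rw [← ENNReal.ofReal_tsum_of_nonneg (dyadicWeight_nonneg s p) hsum]
  exact ENNReal.ofReal_ne_top

theorem pow_le_dyadicWeight_mul {s r : ℝ} {p : ℕ} {k : ℤ} (hr : 0 < r) (hr1 : r ≤ 1)
    (hk : 2 ^ k < r) (hk' : r ≤ 2 ^ (k + 1)) :
    r ^ p ≤ dyadicWeight s p k * ((2 : ℝ) ^ k) ^ s := by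
  have hk0 : k ≤ 0 := by
    by_contra hcon
    exact absurd (hk.trans_le hr1) (not_lt.2 (one_le_zpow₀ (by norm_num) (by omega)))
  obtain ⟨a, ha⟩ := Int.eq_ofNat_of_zero_le (neg_nonneg.2 hk0)
  obtain rfl : k = -(a : ℤ) := by omega
  have h2 : ((2 : ℝ) ^ (-(a : ℤ))) ^ (p : ℝ) =
      ((2 : ℝ) ^ (s - p)) ^ a * ((2 : ℝ) ^ (-(a : ℤ))) ^ s := by
    rw [← Real.rpow_intCast, ← Real.rpow_natCast ((2 : ℝ) ^ (s - p)), ← Real.rpow_mul (by norm_num),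
      ← Real.rpow_mul (by norm_num), ← Real.rpow_mul (by norm_num), ← Real.rpow_add (by norm_num)]
    congr 1
    push_cast
    ring
  calc r ^ p ≤ (2 ^ (-(a : ℤ) + 1)) ^ p := by gcongr
    _ = 2 ^ p * ((2 : ℝ) ^ (-(a : ℤ))) ^ (p : ℝ) := by
        rw [zpow_add₀ (by norm_num), zpow_one, mul_pow, Real.rpow_natCast, mul_comm]
    _ = 2 ^ p * ((2 : ℝ) ^ (s - p)) ^ a * ((2 : ℝ) ^ (-(a : ℤ))) ^ s := by rw [h2, mul_assoc]
    _ ≤ _ := by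
        unfold dyadicWeight
        rw [Int.natAbs_neg, Int.natAbs_natCast]
        gcongr
        exact le_max_left _ _

theorem sq_le_dyadicWeight_mul {s r : ℝ} {p : ℕ} (hp : 2 ≤ p) {k : ℤ} (hr1 : 1 < r)
    (hk' : r ≤ 2 ^ (k + 1)) :
    r ^ 2 ≤ dyadicWeight s p k * ((2 : ℝ) ^ k) ^ s := by
  have hk0 : 0 ≤ k := by
    by_contra hcon
    exact absurd (hr1.trans_le hk') (not_lt.2 (zpow_le_one_of_nonpos₀ (by norm_num) (by omega)))
  obtain ⟨a, rfl⟩ := Int.eq_ofNat_of_zero_le hk0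
  have h2 : ((2 : ℝ) ^ (a : ℤ)) ^ (2 : ℝ) =
      ((2 : ℝ) ^ (2 - s)) ^ a * ((2 : ℝ) ^ (a : ℤ)) ^ s := by
    rw [← Real.rpow_intCast, ← Real.rpow_natCast ((2 : ℝ) ^ (2 - s)), ← Real.rpow_mul (by norm_num),
      ← Real.rpow_mul (by norm_num), ← Real.rpow_mul (by norm_num), ← Real.rpow_add (by norm_num)]
    congr 1
    push_cast
    ring
  calc r ^ 2 ≤ (2 ^ ((a : ℤ) + 1)) ^ 2 := by gcongr
    _ = 2 ^ 2 * ((2 : ℝ) ^ (a : ℤ)) ^ (2 : ℝ) := by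
        rw [zpow_add₀ (by norm_num), zpow_one, mul_pow, Real.rpow_two, mul_comm]
    _ = 2 ^ 2 * ((2 : ℝ) ^ (2 - s)) ^ a * ((2 : ℝ) ^ (a : ℤ)) ^ s := by rw [h2, mul_assoc]
    _ ≤ _ := by
        unfold dyadicWeight
        rw [Int.natAbs_natCast]
        gcongr
        · norm_num
        · exact le_max_right _ _

section WeakType

variable {Ω : Type*} {mΩ : MeasurableSpace Ω} {μ : Measure Ω}
  {B : Type*} [NormedAddCommGroup B] {m : Ω → B}

/-- The truncated moments are bounded by a weighted sum over the dyadic multiples `t = 2 ^ k * y` of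
the quantities `t ^ s * P(‖m‖ > t)`, to which each of the three integrability assumptions applies.
The weights are summable if `2 < s < p`. -/
theorem rpow_mul_truncated_lintegral_le (hm : StronglyMeasurable m) (s : ℝ) {p : ℕ} (hp : 2 ≤ p)
    {y : ℝ} (hy : 0 < y) :
    ENNReal.ofReal (y ^ s) *
      ((ENNReal.ofReal y ^ p)⁻¹ * ∫⁻ ω in {ω | ‖m ω‖ ≤ y}, ‖m ω‖ₑ ^ p ∂μ +
        (ENNReal.ofReal y ^ 2)⁻¹ * ∫⁻ ω in {ω | y < ‖m ω‖}, ‖m ω‖ₑ ^ 2 ∂μ) ≤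
      ∑' k : ℤ, ENNReal.ofReal (dyadicWeight s p k) *
        (ENNReal.ofReal ((2 ^ k * y) ^ s) * μ {ω | 2 ^ k * y < ‖m ω‖}) := by
  have hme : Measurable fun ω => ‖m ω‖ₑ := hm.enorm
  have hmn : Measurable fun ω => ‖m ω‖ := hm.norm.measurable
  have hs₁ : MeasurableSet {ω | ‖m ω‖ ≤ y} := measurableSet_le hmn measurable_const
  have hs₂ : MeasurableSet {ω | y < ‖m ω‖} := measurableSet_lt measurable_const hmn
  have hs : ∀ k : ℤ, MeasurableSet {ω | 2 ^ k * y < ‖m ω‖} := fun k =>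
    measurableSet_lt measurable_const hmn
  have hscal : ∀ (z : B) (q : ℕ), ENNReal.ofReal (y ^ s) * ((ENNReal.ofReal y ^ q)⁻¹ * ‖z‖ₑ ^ q) =
      ENNReal.ofReal (y ^ s * (‖z‖ / y) ^ q) := fun z q => by
    rw [ENNReal.ofReal_mul (by positivity), ENNReal.ofReal_pow (by positivity),
      ENNReal.ofReal_div_of_pos hy, ofReal_norm, ENNReal.div_eq_inv_mul, mul_pow, ENNReal.inv_pow]
  have hpt : ∀ ω, ENNReal.ofReal (y ^ s) *
      ((ENNReal.ofReal y ^ p)⁻¹ * {ω | ‖m ω‖ ≤ y}.indicator (fun ω => ‖m ω‖ₑ ^ p) ω +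
        (ENNReal.ofReal y ^ 2)⁻¹ * {ω | y < ‖m ω‖}.indicator (fun ω => ‖m ω‖ₑ ^ 2) ω) ≤
      ∑' k : ℤ, ENNReal.ofReal (dyadicWeight s p k) * (ENNReal.ofReal ((2 ^ k * y) ^ s) *
        {ω | 2 ^ k * y < ‖m ω‖}.indicator 1 ω) := fun ω => by
    rcases (norm_nonneg (m ω)).eq_or_lt with h0 | h0
    · have h1 : m ω = 0 := norm_eq_zero.1 h0.symm
      have hp0 : p ≠ 0 := by omega
      simp [Set.indicator, h1, hp0]
    -- Only the dyadic level `k` just below `‖m ω‖ / y` is needed.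
    obtain ⟨k, hk, hk'⟩ := exists_mem_Ioc_zpow (div_pos h0 hy) (one_lt_two (α := ℝ))
    have hmem : ω ∈ {ω | 2 ^ k * y < ‖m ω‖} := (lt_div_iff₀ hy).1 hk
    refine le_trans ?_ (ENNReal.le_tsum k)
    rw [Set.indicator_of_mem hmem, Pi.one_apply, mul_one,
      ← ENNReal.ofReal_mul (dyadicWeight_nonneg s p k), Real.mul_rpow (by positivity) hy.le,
      ← mul_assoc, mul_comm (dyadicWeight s p k * _)]
    rcases le_or_gt ‖m ω‖ y with hle | hlt
    · have h1 : ω ∈ {ω | ‖m ω‖ ≤ y} := hle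
      have h2 : ω ∉ {ω | y < ‖m ω‖} := not_lt.2 hle
      rw [Set.indicator_of_mem h1, Set.indicator_of_notMem h2, mul_zero, add_zero, hscal]
      gcongr
      exact pow_le_dyadicWeight_mul (div_pos h0 hy) ((div_le_one hy).2 hle) hk hk'
    · have h1 : ω ∉ {ω | ‖m ω‖ ≤ y} := not_le.2 hlt
      have h2 : ω ∈ {ω | y < ‖m ω‖} := hlt
      rw [Set.indicator_of_notMem h1, Set.indicator_of_mem h2, mul_zero, zero_add, hscal]
      gcongr
      exact sq_le_dyadicWeight_mul hp ((one_lt_div hy).2 hlt) hk'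
  have hL := lintegral_mono (μ := μ) hpt
  rw [lintegral_tsum fun k => by
    have := (measurable_one.indicator (hs k) :
      Measurable ({ω | 2 ^ k * y < ‖m ω‖}.indicator 1 : Ω → ℝ≥0∞))
    fun_prop] at hL
  rw [lintegral_const_mul _ (by
      have h1 := (hme.pow_const p).indicator hs₁
      have h2 := (hme.pow_const 2).indicator hs₂
      fun_prop),
    lintegral_add_left (by
      have h1 := (hme.pow_const p).indicator hs₁
      fun_prop),
    lintegral_const_mul _ ((hme.pow_const p).indicator hs₁),
    lintegral_const_mul _ ((hme.pow_const 2).indicator hs₂),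
    lintegral_indicator hs₁, lintegral_indicator hs₂] at hL
  refine hL.trans_eq (tsum_congr fun k => ?_)
  rw [lintegral_const_mul _ ((measurable_one.indicator (hs k)).const_mul _),
    lintegral_const_mul _ (measurable_one.indicator (hs k)), lintegral_indicator_one (hs k)]

/-- The sum of the terms of a geometric progression that are less than `Z` is at most a multiple of
`Z`, uniformly in the first term `u`. -/
theorem tsum_geometric_lt_le {b u Z : ℝ} (hb : 1 < b) (hu : 0 < u) :
    ∑' j : ℕ, (if u * b ^ j < Z then ENNReal.ofReal (u * b ^ j) else 0) ≤
      ENNReal.ofReal (b / (b - 1) * Z) := by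
  have hb' : 0 < b - 1 := by linarith
  have hb0 : 0 < b := by linarith
  rcases le_or_gt Z 0 with hZ | hZ
  · have : ∀ j : ℕ, ¬ u * b ^ j < Z := fun j => not_lt.2 (hZ.trans (by positivity))
    simp [this]
  refine ENNReal.tsum_le_of_sum_range_le fun n => ?_
  -- The second entry of the minimum is what a complete geometric sum gives; it makes the induction
  -- work as long as the terms are less than `Z`.
  have key : ∑ j ∈ Finset.range n, (if u * b ^ j < Z then u * b ^ j else 0) ≤
      min (b * Z) (u * b ^ n) / (b - 1) := by
    induction n with
    | zero => simp; positivity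
    | succ n ih =>
      rw [Finset.sum_range_succ]
      rw [le_div_iff₀ hb'] at ih ⊢
      have h1 := ih.trans (min_le_left _ _)
      have h2 := ih.trans (min_le_right _ _)
      have h3 : u * b ^ (n + 1) = b * (u * b ^ n) := by ring
      have h4 : 0 < u * b ^ n := by positivity
      rw [h3]
      split_ifs with h
      · refine le_min ?_ ?_ <;> nlinarith
      · refine le_min ?_ ?_ <;> nlinarith
  calc ∑ j ∈ Finset.range n, (if u * b ^ j < Z then ENNReal.ofReal (u * b ^ j) else 0)
      = ENNReal.ofReal (∑ j ∈ Finset.range n, (if u * b ^ j < Z then u * b ^ j else 0)) := by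
        rw [ENNReal.ofReal_sum_of_nonneg fun j _ => by split_ifs <;> positivity]
        refine Finset.sum_congr rfl fun j _ => ?_
        split_ifs <;> simp
    _ ≤ _ := by
        refine ENNReal.ofReal_le_ofReal (key.trans ?_)
        rw [div_mul_eq_mul_div]
        gcongr
        exact min_le_left _ _

/-- Along a geometric progression, the `t ^ s * P(‖m‖ > t)` have a sum bounded by the moment of order
`s`, uniformly in the starting point `v`. -/
theorem tsum_rpow_mul_measure_le (hm : StronglyMeasurable m) {s θ v : ℝ} (hs : 0 < s)
    (hθ : 1 < θ) (hv : 0 < v) :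
    ∑' j : ℕ, ENNReal.ofReal ((v * θ ^ j) ^ s) * μ {ω | v * θ ^ j < ‖m ω‖} ≤
      ENNReal.ofReal (θ ^ s / (θ ^ s - 1)) * ∫⁻ ω, ‖m ω‖ₑ ^ s ∂μ := by
  have hmn : Measurable fun ω => ‖m ω‖ := hm.norm.measurable
  have hset : ∀ j : ℕ, MeasurableSet {ω | v * θ ^ j < ‖m ω‖} := fun j =>
    measurableSet_lt measurable_const hmn
  have hθs : 1 < θ ^ s := Real.one_lt_rpow hθ hs
  calc ∑' j : ℕ, ENNReal.ofReal ((v * θ ^ j) ^ s) * μ {ω | v * θ ^ j < ‖m ω‖}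
      = ∫⁻ ω, ∑' j : ℕ, ENNReal.ofReal ((v * θ ^ j) ^ s) *
          {ω | v * θ ^ j < ‖m ω‖}.indicator 1 ω ∂μ := by
        rw [lintegral_tsum fun j => ((measurable_one.indicator (hset j)).const_mul _).aemeasurable]
        refine tsum_congr fun j => ?_
        rw [lintegral_const_mul _ (measurable_one.indicator (hset j)),
          lintegral_indicator_one (hset j)]
    _ ≤ ∫⁻ ω, ENNReal.ofReal (θ ^ s / (θ ^ s - 1)) * ‖m ω‖ₑ ^ s ∂μ := by
        refine lintegral_mono fun ω => ?_
        rw [← ofReal_norm, ENNReal.ofReal_rpow_of_nonneg (norm_nonneg _) hs.le,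
          ← ENNReal.ofReal_mul (div_nonneg (by positivity) (by linarith))]
        refine le_trans (le_of_eq (tsum_congr fun j => ?_))
          (tsum_geometric_lt_le hθs (Real.rpow_pos_of_pos hv s))
        have hpow : (v * θ ^ j) ^ s = v ^ s * (θ ^ s) ^ j := by
          rw [Real.mul_rpow hv.le (by positivity), ← Real.rpow_natCast, ← Real.rpow_natCast,
            ← Real.rpow_mul (by positivity), ← Real.rpow_mul (by positivity), mul_comm s]
        have hiff : v ^ s * (θ ^ s) ^ j < ‖m ω‖ ^ s ↔ v * θ ^ j < ‖m ω‖ := by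
          rw [← hpow, Real.rpow_lt_rpow_iff (by positivity) (norm_nonneg _) hs]
        simp only [hiff, hpow, Set.indicator, Set.mem_ofPred_eq, Pi.one_apply]
        split_ifs <;> simp
    _ = _ := lintegral_const_mul' _ _ ENNReal.ofReal_ne_top

/-- Dominated convergence for series with summable weights `c` and bounded terms `f`. -/
theorem tendsto_tsum_mul_zero {α ι : Type*} [Countable ι] {l : Filter α}
    [l.IsCountablyGenerated] {c : ι → ℝ≥0∞} (hc : ∑' k, c k ≠ ∞) {f : α → ι → ℝ≥0∞} {W : ℝ≥0∞}
    (hW : W ≠ ∞) (hf : ∀ a k, f a k ≤ W) (h0 : ∀ k, Tendsto (fun a => f a k) l (𝓝 0)) :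
    Tendsto (fun a => ∑' k, c k * f a k) l (𝓝 0) := by
  let _ : MeasurableSpace ι := ⊤
  simp only [← lintegral_count]
  have := tendsto_lintegral_filter_of_dominated_convergence (μ := Measure.count) (l := l)
    (F := fun a k => c k * f a k) (f := fun _ => 0) (fun k => c k * W)
    (Eventually.of_forall fun a => measurable_from_top)
    (Eventually.of_forall fun a => ae_of_all _ fun k => mul_le_mul_right (hf a k) _)
    (by rw [lintegral_count, ENNReal.tsum_mul_right]; exact ENNReal.mul_ne_top hc hW)
    (ae_of_all _ fun k => by
      have := ENNReal.Tendsto.const_mul (a := c k) (h0 k)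
        (Or.inr (ENNReal.ne_top_of_tsum_ne_top hc k))
      simpa using this)
  simpa using this

end WeakType

/-! ### Deviation inequalities -/

namespace Orthomartingale

variable {d : ℕ}

theorem absTwoPow_pos (n : Fin d → ℕ) : 0 < absTwoPow n :=
  Finset.prod_pos fun _ _ => by positivity

theorem absTwoPow_update_succ (n : Fin d → ℕ) (i : Fin d) (k : ℕ) :
    absTwoPow (Function.update n i (k + 1)) = absTwoPow (Function.update n i 1) * 2 ^ k := by
  have h : ∀ a : ℕ, absTwoPow (Function.update n i a) =
      2 ^ a * ∏ q ∈ Finset.univ.erase i, (2 : ℝ) ^ n q := fun a => by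
    rw [absTwoPow, ← Finset.mul_prod_erase _ _ (Finset.mem_univ i), Function.update_self]
    congr 1
    exact Finset.prod_congr rfl fun q hq => by
      rw [Function.update_of_ne (Finset.ne_of_mem_erase hq)]
  rw [h, h]
  ring

theorem tendsto_absTwoPow :
    Tendsto (fun n : Fin d → ℕ => absTwoPow n)
      (comap (fun n : Fin d → ℕ => Finset.univ.sup n) atTop) atTop := by
  have h1 : Tendsto (fun n : Fin d → ℕ => ((Finset.univ.sup n : ℕ) : ℝ))
      (comap (fun n : Fin d → ℕ => Finset.univ.sup n) atTop) atTop :=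
    tendsto_natCast_atTop_atTop.comp tendsto_comap
  refine tendsto_atTop_mono (fun n => ?_) h1
  have hone : ∀ q, (1 : ℝ) ≤ 2 ^ n q := fun q => one_le_pow₀ (by norm_num)
  have hle : ∀ q, (n q : ℝ) ≤ absTwoPow n := fun q => by
    calc (n q : ℝ) ≤ 2 ^ n q := by exact_mod_cast (Nat.lt_two_pow_self (n := n q)).le
      _ ≤ absTwoPow n := by
        rw [absTwoPow, ← Finset.mul_prod_erase _ _ (Finset.mem_univ q)]
        exact le_mul_of_one_le_right (by positivity)
          (Finset.one_le_prod fun r _ => hone r)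
  have hnat : Finset.univ.sup n ≤ ⌊absTwoPow n⌋₊ := Finset.sup_le fun q _ => Nat.le_floor (hle q)
  exact (Nat.le_floor_iff (absTwoPow_pos n).le).1 hnat

theorem ofReal_rpow_mul_measure_le_weakMoment {Ω : Type*} {mΩ : MeasurableSpace Ω} {μ : Measure Ω}
    {B : Type*} [NormedAddCommGroup B] {m : Ω → B} (s : ℝ) {t : ℝ} (ht : 0 < t) :
    ENNReal.ofReal (t ^ s) * μ {ω | t < ‖m ω‖} ≤ weakMoment s m μ :=
  le_iSup₂ (f := fun (t : ℝ) (_ : 0 < t) => ENNReal.ofReal (t ^ s) * μ {ω | t < ‖m ω‖}) t ht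

theorem MemWeakLpZero.weakMoment_ne_top {Ω : Type*} {mΩ : MeasurableSpace Ω} {μ : Measure Ω}
    [IsProbabilityMeasure μ] {B : Type*} [NormedAddCommGroup B] {m : Ω → B} {s : ℝ} (hs : 0 < s)
    (h : MemWeakLpZero s m μ) :
    weakMoment s m μ ≠ ∞ := by
  obtain ⟨t₀, ht₀⟩ := eventually_atTop.1 (h.2.eventually (ge_mem_nhds (zero_lt_one' ℝ≥0∞)))
  have hle : weakMoment s m μ ≤ max 1 (ENNReal.ofReal (t₀ ^ s)) := by
    refine iSup₂_le fun t ht => ?_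
    rcases le_total t₀ t with h1 | h1
    · exact le_max_of_le_left (ht₀ t h1)
    · refine le_max_of_le_right ?_
      calc ENNReal.ofReal (t ^ s) * μ {ω | t < ‖m ω‖} ≤ ENNReal.ofReal (t₀ ^ s) * 1 := by
            gcongr
            exact prob_le_one
        _ = _ := mul_one _
  exact ne_top_of_le_ne_top (by simp) hle

variable {B : Type*} [NormedAddCommGroup B] [NormedSpace ℝ B] [CompleteSpace B]
  [TopologicalSpace.SeparableSpace B]

/-- The estimate from which all parts of the theorem follow. The summable weights `c` depend only on
`s`, `d` and the space. -/
theorem exists_weightedTail_le (hB : IsSmoothSpace B 2) (d : ℕ) {s : ℝ} (hs : 2 < s) :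
    ∃ c : ℤ → ℝ≥0∞, ∑' k, c k ≠ ∞ ∧
      ∀ {Ω : Type*} {F₀ _mΩ : MeasurableSpace Ω} {μ : Measure Ω} {T : Fin d → Ω ≃ᵐ Ω}
        {m : Ω → B}, IsProbabilityMeasure μ → IsCompletelyCommuting μ T F₀ →
        IsOrthoDifference μ T F₀ m → ∀ (x : ℝ) (n : Fin d → ℕ), 0 < x →
        weightedTail μ T m s x n ≤ ENNReal.ofReal (x ^ (-s)) *
          ∑' k : ℤ, c k * (ENNReal.ofReal ((2 ^ k * (√(absTwoPow n) * x)) ^ s) *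
            μ {ω | 2 ^ k * (√(absTwoPow n) * x) < ‖m ω‖}) := by
  -- An even exponent greater than `s`.
  set j : ℕ := ⌈s⌉₊ with hj
  have hjs : s < (2 * j + 2 : ℕ) := by
    have := Nat.le_ceil s
    push_cast
    linarith
  obtain ⟨C, hC⟩ := exists_measure_maxPartialSum_le hB d j
  refine ⟨fun k => C * ENNReal.ofReal (dyadicWeight s (2 * j + 2) k), ?_, ?_⟩
  · rw [ENNReal.tsum_mul_left]
    exact ENNReal.mul_ne_top (by simp) (tsum_dyadicWeight_ne_top hs hjs)
  intro Ω F₀ _mΩ μ T m hμ h hm x n hx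
  have hV := absTwoPow_pos n
  set y := √(absTwoPow n) * x with hy
  have hy0 : 0 < y := by positivity
  have hVn : (∏ q, ((2 ^ n q : ℕ) : ℝ)) = absTwoPow n := by simp [absTwoPow]
  have h1 := hC hμ h hm (fun q => 2 ^ n q) (fun q => Nat.one_le_two_pow) x y hx hy0
    (by rw [hVn, hy, mul_pow, Real.sq_sqrt hV.le])
  rw [hVn] at h1
  have hpow : absTwoPow n ^ (s / 2) = x ^ (-s) * y ^ s := by
    rw [hy, Real.mul_rpow (by positivity) hx.le, Real.sqrt_eq_rpow, ← Real.rpow_mul hV.le,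
      Real.rpow_neg hx.le]
    have : x ^ s ≠ 0 := by positivity
    field_simp
  have h2 := rpow_mul_truncated_lintegral_le (μ := μ)
    (hm.measurable.mono (h.shiftedAlgebra_le 1)) s (p := 2 * j + 2) (by omega) hy0
  calc weightedTail μ T m s x n
      ≤ ENNReal.ofReal (x ^ (-s)) * (ENNReal.ofReal (y ^ s) * (C * _)) := by
        rw [weightedTail, hpow, ENNReal.ofReal_mul (by positivity), mul_assoc]
        gcongr
    _ = ENNReal.ofReal (x ^ (-s)) * (C * (ENNReal.ofReal (y ^ s) * _)) := by
        rw [mul_left_comm (C : ℝ≥0∞)]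
    _ ≤ ENNReal.ofReal (x ^ (-s)) * (C * ∑' k : ℤ,
          ENNReal.ofReal (dyadicWeight s (2 * j + 2) k) *
            (ENNReal.ofReal ((2 ^ k * y) ^ s) * μ {ω | 2 ^ k * y < ‖m ω‖})) := by gcongr
    _ = _ := by simp only [← ENNReal.tsum_mul_left, mul_assoc]

end Orthomartingale

theorem theorem8 (s : ℝ) (hs : 2 < s) (d : ℕ) (hd : 1 < d)
    (B : Type v) [NormedAddCommGroup B] [NormedSpace ℝ B] [CompleteSpace B]
    [TopologicalSpace.SeparableSpace B] (D : ℝ) (hB : IsRDSmooth.{u, v} B 2 D) :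
    ∃ C : ℝ, 0 < C ∧
      ∀ (Ω : Type u) (mΩ : MeasurableSpace Ω) (μ : Measure Ω), IsProbabilityMeasure μ →
      ∀ (T : Fin d → Ω ≃ᵐ Ω) (F₀ : MeasurableSpace Ω) (m : Ω → B),
        Orthomartingale.IsOrthomartingaleDifference μ T F₀ m →
        (Orthomartingale.MemWeakLp s m μ → ∀ x : ℝ, 0 < x →
          (⨆ (n : Fin d → ℕ) (_ : 1 ≤ n), Orthomartingale.weightedTail μ T m s x n)
            ≤ ENNReal.ofReal (C * x ^ (-s)) * Orthomartingale.weakMoment s m μ) ∧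
        (Orthomartingale.MemWeakLpZero s m μ → ∀ x : ℝ, 0 < x →
          Tendsto (fun n : Fin d → ℕ => Orthomartingale.weightedTail μ T m s x n)
            (comap (fun n : Fin d → ℕ => Finset.univ.sup n) atTop) (𝓝 0)) ∧
        (MemLp m (ENNReal.ofReal s) μ → ∀ x : ℝ, 0 < x → ∀ i : Fin d,
          (⨆ (n : Fin d → ℕ) (_ : 1 ≤ n),
            ∑' k : ℕ, Orthomartingale.weightedTail μ T m s x (Function.update n i (k + 1)))
            ≤ ENNReal.ofReal (C * x ^ (-s)) * ∫⁻ ω, ‖m ω‖ₑ ^ s ∂μ) := by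
  obtain ⟨c, hc, htail⟩ := Orthomartingale.exists_weightedTail_le hB.1 d hs
  have hs0 : 0 < s := by linarith
  have hθ : 1 < √(2 : ℝ) := by rw [Real.lt_sqrt] <;> norm_num
  have hθs : 1 < √(2 : ℝ) ^ s := Real.one_lt_rpow hθ hs0
  set A : ℝ := (∑' k, c k).toReal with hA
  have hA0 : 0 ≤ A := ENNReal.toReal_nonneg
  have hAc : ∑' k, c k = ENNReal.ofReal A := (ENNReal.ofReal_toReal hc).symm
  set E : ℝ := √(2 : ℝ) ^ s / (√(2 : ℝ) ^ s - 1) with hE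
  have hE0 : 0 ≤ E := div_nonneg (by positivity) (by linarith)
  refine ⟨A * (1 + E) + 1, by positivity, ?_⟩
  intro Ω mΩ μ hμ T F₀ m hm
  have hcc := hm.completelyCommuting
  have hdiff := hm.isOrthoDifference
  have hmeas : StronglyMeasurable[mΩ] m := hdiff.measurable.mono (hcc.shiftedAlgebra_le 1)
  refine ⟨fun _ x hx => ?_, fun hmem x hx => ?_, fun _ x hx i => ?_⟩
  -- Each term of the dyadic series is at most the weak moment.
  · refine iSup₂_le fun n _ => (htail hμ hcc hdiff x n hx).trans ?_
    have hV := Orthomartingale.absTwoPow_pos n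
    calc _ ≤ ENNReal.ofReal (x ^ (-s)) * ∑' k, c k * Orthomartingale.weakMoment s m μ := by
          gcongr with k
          exact Orthomartingale.ofReal_rpow_mul_measure_le_weakMoment s (by positivity)
      _ = ENNReal.ofReal (A * x ^ (-s)) * Orthomartingale.weakMoment s m μ := by
          rw [ENNReal.tsum_mul_right, hAc, ENNReal.ofReal_mul hA0]
          ring
      _ ≤ _ := by
          gcongr
          nlinarith
  -- Each term of the dyadic series tends to zero and is at most the weak moment, which is finite.
  · have hbound := hmem.weakMoment_ne_top hs0
    have hyt : Tendsto (fun n : Fin d → ℕ => √(Orthomartingale.absTwoPow n) * x)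
        (comap (fun n : Fin d → ℕ => Finset.univ.sup n) atTop) atTop :=
      (Real.tendsto_sqrt_atTop.comp Orthomartingale.tendsto_absTwoPow).atTop_mul_const hx
    have hlim := tendsto_tsum_mul_zero hc hbound
      (f := fun (n : Fin d → ℕ) k =>
        ENNReal.ofReal ((2 ^ k * (√(Orthomartingale.absTwoPow n) * x)) ^ s) *
          μ {ω | 2 ^ k * (√(Orthomartingale.absTwoPow n) * x) < ‖m ω‖})
      (l := comap (fun n : Fin d → ℕ => Finset.univ.sup n) atTop)
      (fun n k => by
        have hV := Orthomartingale.absTwoPow_pos n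
        exact Orthomartingale.ofReal_rpow_mul_measure_le_weakMoment s (by positivity))
      (fun k => hmem.2.comp (hyt.const_mul_atTop (by positivity : (0 : ℝ) < 2 ^ k)))
    have hlim' := ENNReal.Tendsto.const_mul (a := ENNReal.ofReal (x ^ (-s))) hlim
      (Or.inr ENNReal.ofReal_ne_top)
    rw [mul_zero] at hlim'
    exact tendsto_of_tendsto_of_tendsto_of_le_of_le tendsto_const_nhds hlim' (fun _ => zero_le)
      fun n => htail hμ hcc hdiff x n hx
  -- When `n i` increases by one, the dyadic levels are multiplied by `√2`: for each `l` the sum over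
  -- `k` is along a geometric progression.
  · refine iSup₂_le fun n _ => ?_
    set V := Orthomartingale.absTwoPow (Function.update n i 1) with hVdef
    have hV : 0 < V := Orthomartingale.absTwoPow_pos _
    have hy : ∀ k : ℕ, √(Orthomartingale.absTwoPow (Function.update n i (k + 1))) * x =
        √V * x * √2 ^ k := fun k => by
      rw [Orthomartingale.absTwoPow_update_succ, Real.sqrt_mul hV.le]
      have : √((2 : ℝ) ^ k) = √2 ^ k := by
        rw [Real.sqrt_eq_iff_mul_self_eq (by positivity) (by positivity), ← mul_pow,
          Real.mul_self_sqrt (by norm_num)]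
      rw [this]
      ring
    calc ∑' k : ℕ, Orthomartingale.weightedTail μ T m s x (Function.update n i (k + 1))
        ≤ ∑' k : ℕ, ENNReal.ofReal (x ^ (-s)) * ∑' l : ℤ, c l *
            (ENNReal.ofReal ((2 ^ l * (√V * x) * √2 ^ k) ^ s) *
              μ {ω | 2 ^ l * (√V * x) * √2 ^ k < ‖m ω‖}) := by
          refine ENNReal.tsum_le_tsum fun k => (htail hμ hcc hdiff x _ hx).trans_eq ?_
          simp only [hy, mul_assoc]
      _ = ENNReal.ofReal (x ^ (-s)) * ∑' l : ℤ, c l * ∑' k : ℕ,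
            (ENNReal.ofReal ((2 ^ l * (√V * x) * √2 ^ k) ^ s) *
              μ {ω | 2 ^ l * (√V * x) * √2 ^ k < ‖m ω‖}) := by
          rw [ENNReal.tsum_mul_left, ENNReal.tsum_comm]
          simp only [ENNReal.tsum_mul_left]
      _ ≤ ENNReal.ofReal (x ^ (-s)) * ∑' l : ℤ, c l *
            (ENNReal.ofReal E * ∫⁻ ω, ‖m ω‖ₑ ^ s ∂μ) := by
          refine mul_le_mul_right (ENNReal.tsum_le_tsum fun l => mul_le_mul_right ?_ _) _
          exact tsum_rpow_mul_measure_le hmeas hs0 hθ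
            (by positivity : 0 < 2 ^ l * (√V * x))
      _ = ENNReal.ofReal (A * E * x ^ (-s)) * ∫⁻ ω, ‖m ω‖ₑ ^ s ∂μ := by
          rw [ENNReal.tsum_mul_right, hAc, ENNReal.ofReal_mul (by positivity),
            ENNReal.ofReal_mul hA0]
          ring
      _ ≤ _ := by
          gcongr
          nlinarith
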